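/- Let $P$ be a simple polygon in the plane, that is, the closed region bounded by a closed polygonal curve without self-intersections. For $x,y\in P$ let $d(x,y)$ be the geodesic distance, the length of the shortest path $\pi(x,y)$ in $P$ from $x$ to $y$. A chord of $P$ is a line segment contained in $P$ with two distinct endpoints on $\partial P$. A chord with endpoints $p,q$ divides $P$ into two half-polygons (closed, both containing the chord), one containing the boundary path clockwise from $p$ to $q$ and the other the boundary path clockwise from $q$ to $p$. (The chord may touch $\partial P$ in further points, and may be an edge of $P$, in which case one of the half-polygons is the edge itself.) For a half-polygon $H$ let $d(x,H)=\min_{y\in H}d(x,y)$, and for a nonempty finite set $\mathcal H$ of half-polygons of $P$ let $r(x,\mathcal H)=\max_{H\in\mathcal H}d(x,H)$ be the geodesic radius. A set $Q\subseteq P$ is geodesically convex if $\pi(a,b)\subseteq Q$ for all $a,b\in Q$; a function $f$ on $P$ is geodesically convex if for all $a,b\in P$, for points $x\in\pi(a,b)$, the value $f(x)$ is a convex function of $d(a,x)\in[0,d(a,b)]$. Then the geodesic radius function $x\mapsto r(x,\mathcal H)$ is geodesically convex. Moreover, for every real $t$, the geodesic ball $\{x\in P : d(x,H)\le t\}$ of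 any half-polygon $H$ of $P$, and the geodesic ball $\{x\in P : r(x,\mathcal H)\le t\}$, are geodesically convex subsets of $P$. -/

import Mathlib

open Set

noncomputable section

/-- The Euclidean plane. -/
abbrev Plane : Type := EuclideanSpace ℝ (Fin 2)

namespace Polygon

variable {n : ℕ} [NeZero n]

/-- The boundary of a polygon, traversed in the order of its vertices: at time `k + u` with `k` a
natural number and `0 ≤ u < 1` it is at parameter `u` of the edge from vertex `k` to vertex `k + 1`
(vertex indices are read modulo `n`). It is used for times `t ≥ 0` only, and has period `n`. -/
def loop (P : Polygon Plane n) (t : ℝ) : Plane :=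
  P.edgePath ℝ (Fin.ofNat n ⌊t⌋₊) (Int.fract t)

/-- A polygon is simple if it has at least three vertices and its boundary is a closed curve that
does not meet itself. -/
def IsSimple (P : Polygon Plane n) : Prop :=
  3 ≤ n ∧ InjOn P.loop (Ico (0 : ℝ) n)

/-- The closed region bounded by a polygon: the boundary, and all points that the boundary
separates from infinity. -/
def region {n : ℕ} (P : Polygon Plane n) : Set Plane :=
  P.boundary ℝ ∪
    {x | x ∉ P.boundary ℝ ∧ Bornology.IsBounded (connectedComponentIn (P.boundary ℝ)ᶜ x)}

/-- A chord: a segment inside the polygon with distinct endpoints on the boundary. It may touch the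
boundary elsewhere too, and may be an edge. -/
def IsChord {n : ℕ} (P : Polygon Plane n) (p q : Plane) : Prop :=
  p ≠ q ∧ p ∈ P.boundary ℝ ∧ q ∈ P.boundary ℝ ∧ segment ℝ p q ⊆ P.region

/-- The part of the polygon on that side of the segment from `P.loop s` to `P.loop t` which
contains the boundary path from `P.loop s` forward to `P.loop t`: the segment itself, and all
components of the rest of the polygon that meet this path. -/
def sideOfChord (P : Polygon Plane n) (s t : ℝ) : Set Plane :=
  segment ℝ (P.loop s) (P.loop t) ∪
    {x | (connectedComponentIn (P.region \ segment ℝ (P.loop s) (P.loop t)) x ∩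
      P.loop '' Icc s t).Nonempty}

/-- The half-polygons of `P`: the ordered endpoints of a chord, in the direction of traversal of
the boundary, specify the part of `P` that contains the boundary path from the first to the second.
(Exchanging the endpoints gives the other half-polygon of the chord, so the set of all
half-polygons is the same for the clockwise and the counterclockwise direction.) -/
def IsHalfPolygon (P : Polygon Plane n) (H : Set Plane) : Prop :=
  ∃ s t : ℝ, 0 ≤ s ∧ s < n ∧ s < t ∧ t < s + n ∧
    P.IsChord (P.loop s) (P.loop t) ∧ H = P.sideOfChord s t

end Polygon

/-- `γ`, restricted to `[0, 1]`, is a (continuous) path in `S` from `a` to `b`. -/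
def IsPathIn (S : Set Plane) (a b : Plane) (γ : ℝ → Plane) : Prop :=
  ContinuousOn γ (Icc 0 1) ∧ MapsTo γ (Icc 0 1) S ∧ γ 0 = a ∧ γ 1 = b

/-- The length of a path, the supremum of the lengths of inscribed polygonal lines. -/
def pathLength (γ : ℝ → Plane) : ENNReal :=
  eVariationOn γ (Icc 0 1)

/-- `γ` is a shortest path in `S` from `a` to `b`. -/
def IsShortestPath (S : Set Plane) (a b : Plane) (γ : ℝ → Plane) : Prop :=
  IsPathIn S a b γ ∧ ∀ γ', IsPathIn S a b γ' → pathLength γ ≤ pathLength γ'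

/-- The geodesic distance in `S`, the infimum of the lengths of the paths in `S` from `a` to `b`.
(Any two points of a polygon are joined by a path of finite length.) -/
def geodesicDist (S : Set Plane) (a b : Plane) : ℝ :=
  (⨅ (γ : ℝ → Plane) (_ : IsPathIn S a b γ), pathLength γ).toReal

/-- The geodesic distance in `S` from a point to a set. -/
def geodesicInfDist (S : Set Plane) (x : Plane) (H : Set Plane) : ℝ :=
  sInf (geodesicDist S x '' H)

/-- The geodesic radius from `x` to a nonempty finite collection of sets. -/
def geodesicRadius (S : Set Plane) (ℋ : Finset (Set Plane)) (hℋ : ℋ.Nonempty) (x : Plane) : ℝ :=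
  ℋ.sup' hℋ fun H => geodesicInfDist S x H

/-- `Q` is a geodesically convex subset of `S`. -/
def IsGeodesicallyConvex (S Q : Set Plane) : Prop :=
  Q ⊆ S ∧ ∀ a ∈ Q, ∀ b ∈ Q, ∀ γ, IsShortestPath S a b γ → γ '' Icc 0 1 ⊆ Q

/-- `f` is geodesically convex on `S`: for points `x` on a shortest path from `a` to `b`, the value
`f x` is a convex function of the geodesic distance from `a` to `x`. -/
def GeodesicallyConvexFun (S : Set Plane) (f : Plane → ℝ) : Prop :=
  ∀ a ∈ S, ∀ b ∈ S, ∀ γ, IsShortestPath S a b γ →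
    ∃ g : ℝ → ℝ, ConvexOn ℝ (Icc 0 (geodesicDist S a b)) g ∧
      ∀ x ∈ γ '' Icc 0 1, f x = g (geodesicDist S a x)

end

/-! ### Geodesic distance and unit-speed geodesics -/

section

open Filter Topology

/-- The geodesic distance in `S`, with values in `[0, ∞]`. -/
noncomputable def geodesicEDist (S : Set Plane) (a b : Plane) : ENNReal :=
  ⨅ (γ : ℝ → Plane) (_ : IsPathIn S a b γ), pathLength γ

theorem toReal_geodesicEDist (S : Set Plane) (a b : Plane) :
    (geodesicEDist S a b).toReal = geodesicDist S a b := rfl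

theorem eVariationOn_Icc_add_Icc (γ : ℝ → Plane) {p q r : ℝ} (h₁ : p ≤ q) (h₂ : q ≤ r) :
    eVariationOn γ (Icc p q) + eVariationOn γ (Icc q r) = eVariationOn γ (Icc p r) := by
  simpa using eVariationOn.Icc_add_Icc γ (s := univ) h₁ h₂ (mem_univ q)

theorem geodesicEDist_le_eVariationOn {S : Set Plane} {γ : ℝ → Plane} {p q : ℝ} (hpq : p ≤ q)
    (hc : ContinuousOn γ (Icc p q)) (hm : MapsTo γ (Icc p q) S) :
    geodesicEDist S (γ p) (γ q) ≤ eVariationOn γ (Icc p q) := by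
  have hφ : Monotone fun t : ℝ => p + t * (q - p) := fun s t h => by
    have := mul_le_mul_of_nonneg_right h (sub_nonneg.2 hpq)
    simpa using this
  have hφm : MapsTo (fun t : ℝ => p + t * (q - p)) (Icc 0 1) (Icc p q) := fun t ht => by
    have h0 := hφ ht.1
    have h1 := hφ ht.2
    simp only [zero_mul, add_zero, one_mul, add_sub_cancel] at h0 h1
    exact ⟨h0, h1⟩
  refine (iInf₂_le (γ ∘ fun t : ℝ => p + t * (q - p)) ⟨?_, ?_, ?_, ?_⟩).trans ?_
  · exact eVariationOn.comp_le_of_monotoneOn _ _ (hφ.monotoneOn _) hφm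
  · exact hc.comp (by fun_prop) hφm
  · exact hm.comp hφm
  · simp
  · simp

theorem edist_le_geodesicEDist (S : Set Plane) (a b : Plane) : edist a b ≤ geodesicEDist S a b := by
  refine le_iInf₂ fun γ hγ => ?_
  rw [← hγ.2.2.1, ← hγ.2.2.2]
  exact eVariationOn.edist_le γ (left_mem_Icc.2 zero_le_one) (right_mem_Icc.2 zero_le_one)

theorem geodesicEDist_le_edist {S : Set Plane} {a b : Plane} (h : segment ℝ a b ⊆ S) :
    geodesicEDist S a b ≤ edist a b := by
  have hL : LipschitzWith (nndist a b) (AffineMap.lineMap a b : ℝ → Plane) :=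
    lipschitzWith_lineMap a b
  have h1 := geodesicEDist_le_eVariationOn (S := S) (γ := (AffineMap.lineMap a b : ℝ → Plane))
    zero_le_one hL.continuous.continuousOn (fun t ht => h (by
      rw [segment_eq_image_lineMap]; exact mem_image_of_mem _ ht))
  rw [AffineMap.lineMap_apply_zero, AffineMap.lineMap_apply_one] at h1
  refine h1.trans ?_
  have h2 := (hL.lipschitzOnWith (s := univ)).comp_eVariationOn_le (g := id) (s := Icc (0 : ℝ) 1)
    (fun _ _ => mem_univ _)
  rw [eVariationOn_id_Icc] at h2
  simpa only [Function.comp_id, sub_zero, ENNReal.ofReal_one, mul_one, edist_nndist] using h2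

theorem geodesicEDist_triangle (S : Set Plane) (a b c : Plane) :
    geodesicEDist S a c ≤ geodesicEDist S a b + geodesicEDist S b c := by
  unfold geodesicEDist
  simp only [ENNReal.iInf_add, ENNReal.add_iInf]
  refine le_iInf₂ fun γ₁ h₁ => le_iInf₂ fun γ₂ h₂ => ?_
  -- The rewriting of the infima has put the second path outermost: `γ₂` runs from `a` to `b` and
  -- `γ₁` from `b` to `c`.
  set γ : ℝ → Plane := fun t => if t ≤ 1 then γ₂ t else γ₁ (t - 1) with hγ
  have e1 : EqOn γ γ₂ (Icc 0 1) := fun t ht => if_pos ht.2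
  have e2 : EqOn γ (γ₁ ∘ fun t => t - 1) (Icc 1 2) := fun t ht => by
    rcases eq_or_lt_of_le ht.1 with rfl | h
    · simp [hγ, h₁.2.2.1, h₂.2.2.2]
    · exact if_neg (not_le.2 h)
  have m2 : MapsTo (fun t : ℝ => t - 1) (Icc 1 2) (Icc 0 1) := fun t ht =>
    ⟨by linarith [ht.1], by linarith [ht.2]⟩
  have hu : Icc (0 : ℝ) 1 ∪ Icc 1 2 = Icc 0 2 := Icc_union_Icc_eq_Icc (by norm_num) (by norm_num)
  have c1 : ContinuousOn γ (Icc 0 1) := h₂.1.congr e1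
  have c2 : ContinuousOn γ (Icc 1 2) := (h₁.1.comp (by fun_prop) m2).congr e2
  have hmain := geodesicEDist_le_eVariationOn (S := S) (γ := γ) (p := 0) (q := 2) (by norm_num)
    (by rw [← hu]; exact c1.union_of_isClosed c2 isClosed_Icc isClosed_Icc)
    (by
      rw [← hu]
      rintro t (ht | ht)
      · rw [e1 ht]; exact h₂.2.1 ht
      · rw [e2 ht]; exact h₁.2.1 (m2 ht))
  have g0 : γ 0 = a := by rw [e1 (by simp)]; exact h₂.2.2.1
  have g2 : γ 2 = c := by
    rw [e2 (by norm_num)]; norm_num; exact h₁.2.2.2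
  rw [g0, g2] at hmain
  refine hmain.trans ?_
  rw [← eVariationOn_Icc_add_Icc γ (q := 1) (by norm_num) (by norm_num), eVariationOn.congr e1,
    eVariationOn.congr e2]
  exact add_le_add le_rfl (eVariationOn.comp_le_of_monotoneOn _ _
    (fun s _ t _ h => by simpa using h) m2)

theorem geodesicEDist_comm (S : Set Plane) (a b : Plane) :
    geodesicEDist S a b = geodesicEDist S b a := by
  have key : ∀ a b, geodesicEDist S a b ≤ geodesicEDist S b a := fun a b => by
    refine le_iInf₂ fun γ hγ => ?_
    have hm : MapsTo (fun t : ℝ => 1 - t) (Icc 0 1) (Icc 0 1) := fun t ht =>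
      ⟨by linarith [ht.2], by linarith [ht.1]⟩
    refine (iInf₂_le (γ ∘ fun t : ℝ => 1 - t) ⟨hγ.1.comp (by fun_prop) hm, hγ.2.1.comp hm,
      by simpa using hγ.2.2.2, by simpa using hγ.2.2.1⟩).trans ?_
    exact eVariationOn.comp_le_of_antitoneOn _ _ (fun s _ t _ h => by linarith) hm
  exact (key a b).antisymm (key b a)

/-- Compact sets with connected complement which are locally star-shaped and in which any two
points are joined by a path of finite length. -/
structure IsFull (K : Set Plane) : Prop where
  isCompact : IsCompact K
  compl : IsPreconnected Kᶜ
  star : ∀ p ∈ K, ∃ r > 0, ∀ q ∈ K, dist p q < r → segment ℝ p q ⊆ K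
  finite : ∀ a ∈ K, ∀ b ∈ K, geodesicEDist K a b ≠ ⊤

theorem geodesicDist_nonneg (K : Set Plane) (a b : Plane) : 0 ≤ geodesicDist K a b :=
  ENNReal.toReal_nonneg

theorem geodesicDist_comm (K : Set Plane) (a b : Plane) :
    geodesicDist K a b = geodesicDist K b a := by
  rw [← toReal_geodesicEDist, geodesicEDist_comm, toReal_geodesicEDist]

namespace IsFull

variable {K : Set Plane} (hK : IsFull K)
include hK

theorem dist_le {a b : Plane} (ha : a ∈ K) (hb : b ∈ K) : dist a b ≤ geodesicDist K a b := by
  rw [dist_edist]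
  exact ENNReal.toReal_mono (hK.finite a ha b hb) (edist_le_geodesicEDist K a b)

theorem triangle {a b c : Plane} (ha : a ∈ K) (hb : b ∈ K) (hc : c ∈ K) :
    geodesicDist K a c ≤ geodesicDist K a b + geodesicDist K b c := by
  simp only [← toReal_geodesicEDist]
  rw [← ENNReal.toReal_add (hK.finite a ha b hb) (hK.finite b hb c hc)]
  exact ENNReal.toReal_mono (ENNReal.add_ne_top.2 ⟨hK.finite a ha b hb, hK.finite b hb c hc⟩)
    (geodesicEDist_triangle K a b c)

theorem geodesicDist_eq_dist {a b : Plane} (h : segment ℝ a b ⊆ K) :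
    geodesicDist K a b = dist a b := by
  refine le_antisymm ?_ (hK.dist_le (h (left_mem_segment _ _ _)) (h (right_mem_segment _ _ _)))
  rw [dist_edist]
  exact ENNReal.toReal_mono (edist_ne_top _ _) (geodesicEDist_le_edist h)

theorem geodesicDist_self {a : Plane} (ha : a ∈ K) : geodesicDist K a a = 0 := by
  rw [hK.geodesicDist_eq_dist (by simpa using ha), dist_self]

/-- A lower bound for the distance, from a lower bound for the paths through a set that is hit by
all connected sets joining the two points. -/
theorem le_geodesicDist {a b : Plane} (ha : a ∈ K) (hb : b ∈ K) {ρ : ℝ}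
    (h : ∀ S ⊆ K, IsPreconnected S → a ∈ S → b ∈ S →
      ∃ q ∈ S, ρ ≤ geodesicDist K a q + geodesicDist K q b) :
    ρ ≤ geodesicDist K a b := by
  rw [← toReal_geodesicEDist, ← ENNReal.ofReal_le_iff_le_toReal (hK.finite a ha b hb)]
  refine le_iInf₂ fun γ hγ => ?_
  have h01 : (0 : ℝ) ≤ 1 := zero_le_one
  obtain ⟨_, ⟨t, ht, rfl⟩, hq⟩ := h (γ '' Icc 0 1) (image_subset_iff.2 hγ.2.1)
    (isPreconnected_Icc.image _ hγ.1) ⟨0, left_mem_Icc.2 h01, hγ.2.2.1⟩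
    ⟨1, right_mem_Icc.2 h01, hγ.2.2.2⟩
  have htK : γ t ∈ K := hγ.2.1 ht
  calc ENNReal.ofReal ρ
      ≤ ENNReal.ofReal (geodesicDist K a (γ t) + geodesicDist K (γ t) b) :=
        ENNReal.ofReal_le_ofReal hq
    _ = geodesicEDist K a (γ t) + geodesicEDist K (γ t) b := by
        rw [ENNReal.ofReal_add (geodesicDist_nonneg _ _ _) (geodesicDist_nonneg _ _ _),
          ← toReal_geodesicEDist, ← toReal_geodesicEDist,
          ENNReal.ofReal_toReal (hK.finite a ha _ htK), ENNReal.ofReal_toReal (hK.finite _ htK b hb)]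
    _ ≤ eVariationOn γ (Icc 0 t) + eVariationOn γ (Icc t 1) := by
        rw [← hγ.2.2.1, ← hγ.2.2.2]
        exact add_le_add
          (geodesicEDist_le_eVariationOn ht.1 (hγ.1.mono (Icc_subset_Icc_right ht.2))
            (hγ.2.1.mono_left (Icc_subset_Icc_right ht.2)))
          (geodesicEDist_le_eVariationOn ht.2 (hγ.1.mono (Icc_subset_Icc_left ht.1))
            (hγ.2.1.mono_left (Icc_subset_Icc_left ht.1)))
    _ = pathLength γ := eVariationOn_Icc_add_Icc γ ht.1 ht.2

/-- Near a point of K, geodesic and Euclidean distance from that point agree by local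
star-shapedness, so the triangle inequality gives continuity for the Euclidean topology. -/
theorem continuousOn_geodesicDist {a : Plane} (ha : a ∈ K) :
    ContinuousOn (geodesicDist K a) K := by
  rw [Metric.continuousOn_iff]
  intro x hx ε hε
  obtain ⟨r, hr, hs⟩ := hK.star x hx
  refine ⟨min r ε, lt_min hr hε, fun y hy hxy => ?_⟩
  rw [dist_comm] at hxy
  have h1 := hK.geodesicDist_eq_dist (hs y hy (hxy.trans_le (min_le_left _ _)))
  have h2 := hK.triangle ha hx hy
  have h3 := hK.triangle ha hy hx
  rw [geodesicDist_comm K y x] at h3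
  rw [Real.dist_eq, abs_lt]
  constructor <;> linarith [hxy.trans_le (min_le_right r ε)]

/-- Every connected set joining x to y meets the geodesic sphere of radius s about x. If all points
of the sphere were farther than d(x, y) - s + ε from y, then d(x, y) would exceed itself by ε.
Compactness of the sphere removes the ε. -/
theorem exists_between {x y : Plane} (hx : x ∈ K) (hy : y ∈ K) {s : ℝ} (h0 : 0 ≤ s)
    (hs : s ≤ geodesicDist K x y) :
    ∃ z ∈ K, geodesicDist K x z = s ∧ geodesicDist K z y = geodesicDist K x y - s := by
  have key : ∀ ε > 0, ∃ z ∈ K, geodesicDist K x z = s ∧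
      geodesicDist K z y ≤ geodesicDist K x y - s + ε := by
    intro ε hε
    by_contra! hcon
    have : geodesicDist K x y + ε ≤ geodesicDist K x y := by
      refine hK.le_geodesicDist hx hy fun S hSK hS hxS hyS => ?_
      obtain ⟨z, hzS, hz⟩ := hS.intermediate_value hxS hyS
        ((hK.continuousOn_geodesicDist hx).mono hSK)
        (show s ∈ _ from ⟨by rw [hK.geodesicDist_self hx]; exact h0, hs⟩)
      exact ⟨z, hzS, by linarith [hcon z (hSK hzS) hz]⟩
    linarith
  have hc : IsCompact (K ∩ geodesicDist K x ⁻¹' {s}) :=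
    hK.isCompact.of_isClosed_subset ((hK.continuousOn_geodesicDist hx).preimage_isClosed_of_isClosed
      hK.isCompact.isClosed isClosed_singleton) inter_subset_left
  obtain ⟨w, hw, hws, -⟩ := key 1 one_pos
  obtain ⟨z, ⟨hz, hzs⟩, hmin⟩ := hc.exists_isMinOn ⟨w, hw, hws⟩
    ((hK.continuousOn_geodesicDist hy).mono inter_subset_left)
  refine ⟨z, hz, hzs, le_antisymm ?_ ?_⟩
  · refine le_of_forall_pos_le_add fun ε hε => ?_
    obtain ⟨w, hw, hws, hwy⟩ := key ε hε
    have := hmin ⟨hw, hws⟩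
    simp only [mem_ofPred_eq] at this
    rw [geodesicDist_comm K y z, geodesicDist_comm K y w] at this
    exact this.trans hwy
  · have := hK.triangle hx hz hy
    rw [show geodesicDist K x z = s from hzs] at this
    linarith

end IsFull

/-- `σ`, restricted to `[0, ℓ]`, is a path of unit speed in `K` that realizes all distances. -/
def IsUnitGeodesic (K : Set Plane) (σ : ℝ → Plane) (ℓ : ℝ) : Prop :=
  MapsTo σ (Icc 0 ℓ) K ∧
    ∀ s ∈ Icc 0 ℓ, ∀ t ∈ Icc 0 ℓ, s ≤ t → geodesicDist K (σ s) (σ t) = t - s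

/-- Geodesics without a limit of paths: Zorn gives a maximal set E containing x and y on which d(p,
q) = |φ p - φ q|, where φ is the distance from x. It is closed, and by `exists_between` φ leaves no
gap on it, so the inverse of φ on E is the geodesic. -/
theorem IsFull.exists_isUnitGeodesic {K : Set Plane} (hK : IsFull K) {x y : Plane} (hx : x ∈ K)
    (hy : y ∈ K) : ∃ σ, IsUnitGeodesic K σ (geodesicDist K x y) ∧ σ 0 = x ∧
      σ (geodesicDist K x y) = y := by
  set D := geodesicDist K x y with hD
  have hD0 : 0 ≤ D := geodesicDist_nonneg _ _ _
  set φ := geodesicDist K x with hφ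
  let F : Set (Set Plane) := {E | E ⊆ K ∧ ∀ p ∈ E, ∀ q ∈ E, geodesicDist K p q = |φ p - φ q|}
  have hxx : φ x = 0 := hK.geodesicDist_self hx
  have h0 : ({x, y} : Set Plane) ∈ F := by
    refine ⟨by rintro _ (rfl | rfl) <;> assumption, ?_⟩
    rintro _ (rfl | rfl) _ (rfl | rfl)
    · simp [hK.geodesicDist_self hx]
    · rw [hxx, zero_sub, abs_neg, abs_of_nonneg (geodesicDist_nonneg _ _ _)]
    · rw [hxx, sub_zero, abs_of_nonneg (geodesicDist_nonneg _ _ _), geodesicDist_comm]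
    · simp [hK.geodesicDist_self hy]
  obtain ⟨E, hE0, hE⟩ := zorn_subset_nonempty F (fun c hcF hc hne => by
    refine ⟨⋃₀ c, ⟨sUnion_subset fun E hE => (hcF hE).1, ?_⟩, fun E hE => subset_sUnion_of_mem hE⟩
    rintro p ⟨E₁, hE₁, hp⟩ q ⟨E₂, hE₂, hq⟩
    rcases hc.total hE₁ hE₂ with h | h
    · exact (hcF hE₂).2 p (h hp) q hq
    · exact (hcF hE₁).2 p hp q (h hq)) _ h0
  have hEK := hE.prop.1
  have hEd := hE.prop.2
  have hxE : x ∈ E := hE0 (by simp)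
  have hyE : y ∈ E := hE0 (by simp)
  have hins : ∀ z ∈ K, (∀ p ∈ E, geodesicDist K p z = |φ p - φ z|) → z ∈ E := by
    intro z hz h
    refine hE.le_of_ge (y := insert z E) ⟨insert_subset hz hEK, ?_⟩ (subset_insert _ _)
      (mem_insert _ _)
    rintro p (rfl | hp) q (rfl | hq)
    · simp [hK.geodesicDist_self hz]
    · rw [geodesicDist_comm, h q hq, abs_sub_comm]
    · exact h p hp
    · exact hEd p hp q hq
  have hφc : ContinuousOn φ K := hK.continuousOn_geodesicDist hx
  have hEcl : IsClosed E := by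
    rw [← closure_subset_iff_isClosed]
    intro z hz
    have hzK : z ∈ K := hK.isCompact.isClosed.closure_subset_iff.2 hEK hz
    refine hins z hzK fun p hp => ?_
    have hEc : E ⊆ {w ∈ K | geodesicDist K p w - |φ p - φ w| = 0} := fun w hw =>
      ⟨hEK hw, sub_eq_zero.2 (hEd p hp w hw)⟩
    have hcl : IsClosed {w ∈ K | geodesicDist K p w - |φ p - φ w| = 0} :=
      ((hK.continuousOn_geodesicDist (hEK hp)).sub
        (continuousOn_const.sub hφc).abs).preimage_isClosed_of_isClosed
          hK.isCompact.isClosed isClosed_singleton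
    exact sub_eq_zero.1 (closure_minimal hEc hcl hz).2
  have hEcpt : IsCompact E := hK.isCompact.of_isClosed_subset hEcl hEK
  have hsurj : ∀ s ∈ Icc 0 D, ∃ z ∈ E, φ z = s := by
    intro s hs
    have hφE := hφc.mono hEK
    -- `p` is the last point of E up to level s and `q` the first one from level s on. A point
    -- between them at level s is compatible with all of E, because every other point of E lies
    -- beyond `p` or beyond `q`.
    obtain ⟨p, ⟨hpE, hps⟩, hpmax⟩ := (hEcpt.of_isClosed_subset
      (hφE.preimage_isClosed_of_isClosed hEcl isClosed_Iic) inter_subset_left).exists_isMaxOn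
        (s := E ∩ φ ⁻¹' Iic s) ⟨x, hxE, by rw [mem_preimage, hxx]; exact hs.1⟩
        (hφE.mono inter_subset_left)
    obtain ⟨q, ⟨hqE, hqs⟩, hqmin⟩ := (hEcpt.of_isClosed_subset
      (hφE.preimage_isClosed_of_isClosed hEcl isClosed_Ici) inter_subset_left).exists_isMinOn
        (s := E ∩ φ ⁻¹' Ici s) ⟨y, hyE, hs.2⟩ (hφE.mono inter_subset_left)
    simp only [mem_preimage, mem_Iic, mem_Ici] at hps hqs
    have hpq : geodesicDist K p q = φ q - φ p := by
      rw [hEd p hpE q hqE, abs_sub_comm, abs_of_nonneg (by linarith)]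
    obtain ⟨z, hz, hz1, hz2⟩ := hK.exists_between (hEK hpE) (hEK hqE) (s := s - φ p)
      (by linarith) (by linarith)
    have hzs : φ z = s := by
      have h1 := hK.triangle hx (hEK hpE) hz
      have h2 := hK.triangle hx hz (hEK hqE)
      change φ z ≤ φ p + _ at h1
      change φ q ≤ φ z + _ at h2
      linarith
    refine ⟨z, hins z hz fun w hw => ?_, hzs⟩
    have hwK := hEK hw
    have hlow : |φ w - φ z| ≤ geodesicDist K w z := by
      have h1 := hK.triangle hx hwK hz
      have h2 := hK.triangle hx hz hwK
      rw [geodesicDist_comm K z w] at h2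
      change φ z ≤ φ w + _ at h1
      change φ w ≤ φ z + _ at h2
      rw [abs_le]; constructor <;> linarith
    refine le_antisymm ?_ hlow
    rcases le_total (φ w) s with h | h
    · have h1 : φ w ≤ φ p := hpmax ⟨hw, h⟩
      have h2 := hK.triangle hwK (hEK hpE) hz
      rw [hEd w hw p hpE, abs_sub_comm, abs_of_nonneg (by linarith)] at h2
      rw [abs_sub_comm, hzs, abs_of_nonneg (by linarith)]
      linarith
    · have h1 : φ q ≤ φ w := hqmin ⟨hw, h⟩
      have h2 := hK.triangle hz (hEK hqE) hwK
      rw [hEd q hqE w hw, abs_sub_comm, abs_of_nonneg (by linarith), geodesicDist_comm] at h2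
      rw [hzs, abs_of_nonneg (by linarith)]
      linarith
  choose! σ hσE hσφ using hsurj
  refine ⟨σ, ⟨fun s hs => hEK (hσE s hs), fun s hs t ht hst => ?_⟩, ?_, ?_⟩
  · rw [hEd _ (hσE s hs) _ (hσE t ht), hσφ s hs, hσφ t ht, abs_sub_comm,
      abs_of_nonneg (by linarith)]
  · have h := hσφ 0 (left_mem_Icc.2 hD0)
    have h' := hEd _ hxE _ (hσE 0 (left_mem_Icc.2 hD0))
    rw [h, hxx, sub_zero, abs_zero] at h'
    have := hK.dist_le hx (hEK (hσE 0 (left_mem_Icc.2 hD0)))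
    rw [h'] at this
    exact (dist_le_zero.1 this).symm
  · have h := hσφ D (right_mem_Icc.2 hD0)
    have h' := hEd _ hyE _ (hσE D (right_mem_Icc.2 hD0))
    rw [h, show φ y = D from rfl, sub_self, abs_zero] at h'
    have := hK.dist_le hy (hEK (hσE D (right_mem_Icc.2 hD0)))
    rw [h'] at this
    exact (dist_le_zero.1 this).symm

end

/-! ### Chords separate: a continuous logarithm on K -/

section

open Filter Topology Complex

/-- The rotation of the plane by a right angle. -/
noncomputable def rot (u : Plane) : Plane := !₂[-u 1, u 0]

theorem inner_eq_coord (x y : Plane) : inner ℝ x y = x 0 * y 0 + x 1 * y 1 := by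
  simp [PiLp.inner_apply, Fin.sum_univ_two, mul_comm]

@[simp] theorem rot_zero (u : Plane) : rot u 0 = -u 1 := rfl

@[simp] theorem rot_one (u : Plane) : rot u 1 = u 0 := rfl

theorem inner_rot_self (u : Plane) : inner ℝ (rot u) u = 0 := by
  rw [inner_eq_coord]; simp; ring

theorem coord_sq_of_norm_eq_one {u : Plane} (hu : ‖u‖ = 1) : u 0 * u 0 + u 1 * u 1 = 1 := by
  rw [← inner_eq_coord, real_inner_self_eq_norm_sq, hu, one_pow]

theorem eq_inner_smul_add {u : Plane} (hu : ‖u‖ = 1) (x : Plane) :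
    x = inner ℝ x u • u + inner ℝ x (rot u) • rot u := by
  have h := coord_sq_of_norm_eq_one hu
  ext i
  fin_cases i
  · simp [inner_eq_coord]; linear_combination (-x 0) * h
  · simp [inner_eq_coord]; linear_combination (-x 1) * h

theorem segment_subset_iff_of_le {z n : Plane} {a b : ℝ} (h : a ≤ b) {K : Set Plane} :
    segment ℝ (z + a • n) (z + b • n) ⊆ K ↔ ∀ t ∈ Icc a b, z + t • n ∈ K := by
  have himg : segment ℝ (z + a • n) (z + b • n) = (fun t : ℝ => z + t • n) '' segment ℝ a b := by
    have := image_segment ℝ (AffineMap.lineMap z (z + n) : ℝ →ᵃ[ℝ] Plane) a b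
    simp only [AffineMap.lineMap_apply, vsub_eq_sub, vadd_eq_add, add_sub_cancel_left] at this
    simp only [add_comm z]
    rw [← this]
    refine image_congr' fun t => ?_
    simp [AffineMap.lineMap_apply]
  rw [himg, segment_eq_Icc h, image_subset_iff]
  rfl

theorem segment_ray_subset_iff {z n : Plane} {b : ℝ} (h : 0 ≤ b) {K : Set Plane} :
    segment ℝ z (z + b • n) ⊆ K ↔ ∀ t ∈ Icc 0 b, z + t • n ∈ K := by
  rw [← segment_subset_iff_of_le h, zero_smul, add_zero]

/-- The chord of `K` through `z` perpendicular to `u`. -/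
def chord (K : Set Plane) (z u : Plane) : Set Plane :=
  {x | inner ℝ (x - z) u = 0 ∧ segment ℝ z x ⊆ K}

theorem chord_subset (K : Set Plane) (z u : Plane) : chord K z u ⊆ K :=
  fun _ hx => hx.2 (right_mem_segment _ _ _)

/-- Beyond the end of the visible part of the ray there is a gap: a point of K just past it would be
visible by star-shapedness. `β` is taken inside this gap, so the ray up to `β` meets K only in the
visible part. -/
theorem IsFull.exists_chord_end {K : Set Plane} (hK : IsFull K) {z n : Plane} (hz : z ∈ K)
    (hn : ‖n‖ = 1) : ∃ β : ℝ, 0 < β ∧ z + β • n ∉ K ∧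
      ∀ t ∈ Icc 0 β, z + t • n ∈ K → segment ℝ z (z + t • n) ⊆ K := by
  set Λ : Set ℝ := {t | 0 ≤ t ∧ segment ℝ z (z + t • n) ⊆ K} with hΛ
  have h0 : (0 : ℝ) ∈ Λ := ⟨le_rfl, by simpa using hz⟩
  obtain ⟨R, hR⟩ := hK.isCompact.isBounded.subset_closedBall z
  have hbdd : BddAbove Λ := ⟨R, fun t ht => by
    have := hR (ht.2 (right_mem_segment _ _ _))
    simpa [norm_smul, hn, abs_of_nonneg ht.1] using this⟩
  set m := sSup Λ with hm
  have hm0 : 0 ≤ m := le_csSup hbdd h0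
  have hlt : ∀ t, 0 ≤ t → t < m → z + t • n ∈ K := fun t ht htm => by
    obtain ⟨s, hs, hts⟩ := exists_lt_of_lt_csSup ⟨0, h0⟩ htm
    exact (segment_ray_subset_iff hs.1).1 hs.2 t ⟨ht, hts.le⟩
  have hmK : z + m • n ∈ K := by
    rcases hm0.eq_or_lt with h | h
    · rw [← h]; simpa using hz
    · have hc : Tendsto (fun t : ℝ => z + t • n) (𝓝[<] m) (𝓝 (z + m • n)) :=
        (Continuous.tendsto (by fun_prop) m).mono_left nhdsWithin_le_nhds
      refine hK.isCompact.isClosed.mem_of_tendsto hc ?_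
      filter_upwards [Ioo_mem_nhdsLT h] with t ht using hlt t ht.1.le ht.2
  have hmle : ∀ t, 0 ≤ t → t ≤ m → z + t • n ∈ K := fun t ht htm => by
    rcases htm.eq_or_lt with rfl | h
    · exact hmK
    · exact hlt t ht h
  obtain ⟨r, hr, hs⟩ := hK.star _ hmK
  have hout : ∀ t, m < t → t ≤ m + r / 2 → z + t • n ∉ K := by
    intro t h1 h2 htK
    have h3 := hs _ htK (by
      rw [dist_eq_norm, show z + m • n - (z + t • n) = (m - t) • n by module, norm_smul, hn,
        Real.norm_eq_abs, abs_sub_comm, abs_of_pos (by linarith)]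
      linarith)
    rw [segment_subset_iff_of_le h1.le] at h3
    have : t ∈ Λ := ⟨hm0.trans h1.le, (segment_ray_subset_iff (hm0.trans h1.le)).2 fun s hs => by
      rcases le_total s m with h | h
      · exact hmle s hs.1 h
      · exact h3 s ⟨h, hs.2⟩⟩
    exact (le_csSup hbdd this).not_gt h1
  refine ⟨m + r / 2, by linarith, hout _ (by linarith) le_rfl, fun t ht htK => ?_⟩
  have htm : t ≤ m := not_lt.1 fun h => hout t h ht.2 htK
  exact (segment_ray_subset_iff ht.1).2 fun s hs => hmle s hs.1 (hs.2.trans htm)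

/-- If the complement of `K` is connected, the quotient of the distances to two points of the
complement has a continuous logarithm on `K`. -/
theorem exists_continuousOn_log {K : Set Plane} (hcl : IsClosed K) (hc : IsPreconnected Kᶜ)
    {φ : Plane → ℂ} (hφ : Isometry φ) {e e' : Plane} (he : e ∉ K) (he' : e' ∉ K) :
    ∃ L : Plane → ℂ, ContinuousOn L K ∧ ∀ x ∈ K, exp (L x) = (φ x - φ e) / (φ x - φ e') := by
  have hne : ∀ {e x}, e ∉ K → x ∈ K → φ x - φ e ≠ 0 := fun he hx =>
    sub_ne_zero.2 fun h => he (hφ.injective h ▸ hx)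
  have loc : ∀ e ∉ K, ∃ r > 0, ∀ a ∈ Metric.ball e r, a ∉ K ∧ ∃ L : Plane → ℂ, ContinuousOn L K ∧
      ∀ x ∈ K, exp (L x) = (φ x - φ a) / (φ x - φ e) := by
    intro e he
    obtain ⟨r, hr, hball⟩ := Metric.isOpen_iff.1 hcl.isOpen_compl e he
    refine ⟨r, hr, fun a ha => ⟨hball ha, fun x => log ((φ x - φ a) / (φ x - φ e)), ?_, ?_⟩⟩
    · refine ContinuousOn.clog ?_ fun x hx => ?_
      · exact ((hφ.continuous.sub continuous_const).continuousOn).div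
          ((hφ.continuous.sub continuous_const).continuousOn) fun x hx => hne he hx
      -- The quotient is within distance 1 of 1, because |e - a| < r ≤ |x - e|; so the principal
      -- logarithm is continuous on it.
      · have h1 : (φ x - φ a) / (φ x - φ e) = 1 + (φ e - φ a) / (φ x - φ e) := by
          rw [eq_comm, ← div_self (hne he hx), ← add_div]; ring
        rw [h1]
        refine mem_slitPlane_of_norm_lt_one ?_
        rw [norm_div, div_lt_one (norm_pos_iff.2 (hne he hx)), ← dist_eq_norm, ← dist_eq_norm,
          hφ.dist_eq, hφ.dist_eq, dist_comm]
        refine lt_of_lt_of_le ha (not_lt.1 fun h => ?_)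
        exact hball (Metric.mem_ball.2 h) hx
    · intro x hx
      exact exp_log (div_ne_zero (hne (hball ha) hx) (hne he hx))
  set A : Set Plane := {a | a ∉ K ∧ ∃ L : Plane → ℂ, ContinuousOn L K ∧
    ∀ x ∈ K, exp (L x) = (φ x - φ a) / (φ x - φ e')} with hA
  have hAo : IsOpen A := by
    refine Metric.isOpen_iff.2 fun a ha => ?_
    obtain ⟨r, hr, h⟩ := loc a ha.1
    refine ⟨r, hr, fun b hb => ⟨(h b hb).1, ?_⟩⟩
    obtain ⟨L, hL, hL'⟩ := ha.2
    obtain ⟨M, hM, hM'⟩ := (h b hb).2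
    refine ⟨fun x => L x + M x, hL.add hM, fun x hx => ?_⟩
    have := hne ha.1 hx
    have := hne he' hx
    rw [exp_add, hL' x hx, hM' x hx]
    field_simp
  have hsub : Kᶜ ⊆ A := by
    -- The admissible points `a` form a set that is open and relatively closed in the connected
    -- complement, and it contains `e'` with logarithm 0.
    refine hc.subset_of_closure_inter_subset hAo ⟨e', he', he', fun _ => 0, continuousOn_const,
      fun x hx => by rw [exp_zero, div_self (hne he' hx)]⟩ ?_
    rintro a ⟨ha, haK⟩
    obtain ⟨r, hr, h⟩ := loc a haK
    obtain ⟨b, hb, hab⟩ := Metric.mem_closure_iff.1 ha r hr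
    obtain ⟨L, hL, hL'⟩ := hb.2
    obtain ⟨M, hM, hM'⟩ := (h b (by rwa [Metric.mem_ball, dist_comm])).2
    refine ⟨haK, fun x => L x - M x, hL.sub hM, fun x hx => ?_⟩
    have := hne haK hx
    have := hne he' hx
    have := hne hb.1 hx
    rw [exp_sub, hL' x hx, hM' x hx]
    field_simp
  exact (hsub he).2

/-- G takes values in 2πiℤ; a change of value would force, by connectedness, an imaginary part at an
odd multiple of π. -/
theorem eqOn_of_exp_eq_one {S : Set Plane} (hS : IsPreconnected S) {G : Plane → ℂ}
    (hG : ContinuousOn G S) (h : ∀ x ∈ S, exp (G x) = 1) {x y : Plane} (hx : x ∈ S) (hy : y ∈ S) :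
    G x = G y := by
  have key : ∀ x ∈ S, ∀ y ∈ S, ¬ (G x).im < (G y).im := by
    intro x hx y hy hlt
    obtain ⟨k, hk⟩ := exp_eq_one_iff.1 (h x hx)
    obtain ⟨l, hl⟩ := exp_eq_one_iff.1 (h y hy)
    have hk' : (G x).im = k * (2 * Real.pi) := by rw [hk]; simp
    have hl' : (G y).im = l * (2 * Real.pi) := by rw [hl]; simp
    have hpi := Real.pi_pos
    have hkl : k < l := by
      rw [hk', hl'] at hlt
      exact_mod_cast lt_of_mul_lt_mul_right hlt (by positivity)
    have hkl' : (k : ℝ) + 1 ≤ l := by exact_mod_cast hkl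
    obtain ⟨w, hw, hwv⟩ := hS.intermediate_value hx hy (continuous_im.comp_continuousOn hG)
      (show ((k : ℝ) + 1 / 2) * (2 * Real.pi) ∈ _ from
        ⟨by simp only [Function.comp_apply, hk']; nlinarith,
          by simp only [Function.comp_apply, hl']; nlinarith⟩)
    obtain ⟨j, hj⟩ := exp_eq_one_iff.1 (h w hw)
    have hj' : (G w).im = j * (2 * Real.pi) := by rw [hj]; simp
    simp only [Function.comp_apply, hj'] at hwv
    have h2 : (j : ℝ) = k + 1 / 2 := mul_right_cancel₀ (by positivity) hwv
    have h3 : (2 * j : ℝ) = 2 * k + 1 := by linarith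
    have h4 : 2 * j = 2 * k + 1 := by exact_mod_cast h3
    omega
  obtain ⟨k, hk⟩ := exp_eq_one_iff.1 (h x hx)
  obtain ⟨l, hl⟩ := exp_eq_one_iff.1 (h y hy)
  refine Complex.ext (by rw [hk, hl]; simp) (le_antisymm ?_ ?_)
  · exact not_lt.1 (key y hy x hx)
  · exact not_lt.1 (key x hx y hy)

/-- A chord separates the points just before it from the points just behind it. -/
theorem IsFull.chord_separates {K : Set Plane} (hK : IsFull K) {z u : Plane} (hu : ‖u‖ = 1) {ε : ℝ}
    (hε : 0 < ε) (hseg : ∀ t ∈ Icc (-ε) ε, z + t • u ∈ K) {S : Set Plane} (hS : IsPreconnected S)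
    (hSK : S ⊆ K) (hd : Disjoint S (chord K z u)) (h₁ : z + (-ε) • u ∈ S) (h₂ : z + ε • u ∈ S) :
    False := by
  have hz : z ∈ K := by simpa using hseg 0 ⟨by linarith, hε.le⟩
  have hu2 := coord_sq_of_norm_eq_one hu
  set n := rot u with hn
  have hn1 : ‖n‖ = 1 := by
    have : ‖n‖ ^ 2 = 1 := by
      rw [← real_inner_self_eq_norm_sq, inner_eq_coord]; simp [hn]; linarith
    nlinarith [norm_nonneg n]
  have hnu : inner ℝ n u = 0 := inner_rot_self u
  have hun : inner ℝ u n = 0 := by rw [real_inner_comm]; exact hnu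
  obtain ⟨β, hβ, hβK, hβs⟩ := hK.exists_chord_end hz hn1
  obtain ⟨α, hα, hαK, hαs⟩ := hK.exists_chord_end (n := -n) hz (by rwa [norm_neg])
  -- Complex coordinates with origin z and real axis along `u`: the chord lies on the imaginary
  -- axis, between the points -iα and iβ outside K.
  set φ : Plane → ℂ := fun x => ⟨inner ℝ (x - z) u, inner ℝ (x - z) n⟩ with hφ
  have hφi : Isometry φ := by
    refine Isometry.of_dist_eq fun x y => ?_
    have h1 : φ x - φ y = ⟨inner ℝ (x - y) u, inner ℝ (x - y) n⟩ := by
      apply Complex.ext <;> simp [hφ, inner_sub_left]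
    have h2 : ‖φ x - φ y‖ ^ 2 = ‖x - y‖ ^ 2 := by
      rw [h1, ← Complex.normSq_eq_norm_sq, Complex.normSq_mk, ← real_inner_self_eq_norm_sq,
        inner_eq_coord, inner_eq_coord, inner_eq_coord]
      simp only [hn, rot_zero, rot_one]
      linear_combination ((x - y) 0 ^ 2 + (x - y) 1 ^ 2) * hu2
    rw [dist_eq_norm, dist_eq_norm]
    exact (sq_eq_sq₀ (norm_nonneg _) (norm_nonneg _)).1 h2
  obtain ⟨L, hL, hLe⟩ := exists_continuousOn_log hK.isCompact.isClosed hK.compl hφi hβK hαK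
  have hφβ : φ (z + β • n) = ⟨0, β⟩ := by
    apply Complex.ext <;> simp [hφ, inner_smul_left, hnu, hn1]
  have hφα : φ (z + α • -n) = ⟨0, -α⟩ := by
    apply Complex.ext <;> simp [hφ, inner_smul_left, hnu, hn1]
  set R : Plane → ℂ := fun x => (φ x - ⟨0, β⟩) / (φ x - ⟨0, -α⟩) with hR
  have hden : ∀ x ∈ K, φ x - ⟨0, -α⟩ ≠ 0 := fun x hx => by
    rw [← hφα]; exact sub_ne_zero.2 fun h => hαK (hφi.injective h ▸ hx)
  have hnum : ∀ x ∈ K, φ x - ⟨0, β⟩ ≠ 0 := fun x hx => by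
    rw [← hφβ]; exact sub_ne_zero.2 fun h => hβK (hφi.injective h ▸ hx)
  have hRc : ContinuousOn R K := (hφi.continuous.sub continuous_const).continuousOn.div
    (hφi.continuous.sub continuous_const).continuousOn hden
  have hRre : ∀ x, (R x).re = ((φ x).re ^ 2 + ((φ x).im - β) * ((φ x).im + α)) /
      normSq (φ x - ⟨0, -α⟩) := fun x => by
    simp only [hR, div_re, sub_re, sub_im]; ring
  have hRim : ∀ x, (R x).im = (-(φ x).re * (α + β)) / normSq (φ x - ⟨0, -α⟩) := fun x => by
    simp only [hR, div_im, sub_re, sub_im]; ring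
  -- `R x` is a nonpositive real exactly on the segment from -iα to iβ, and by the choice of α and β
  -- all points of K there belong to the chord.
  have hslit : ∀ x ∈ K, x ∉ chord K z u → R x ∈ slitPlane := by
    intro x hx hxC
    by_contra hns
    rw [mem_slitPlane_iff, not_or, not_lt, not_not] at hns
    have hpos : 0 < normSq (φ x - ⟨0, -α⟩) := normSq_pos.2 (hden x hx)
    have hre : (φ x).re = 0 := by
      have := hns.2
      rw [hRim, div_eq_zero_iff] at this
      rcases this with h | h
      · rcases mul_eq_zero.1 h with h | h
        · linarith
        · exact absurd h (add_pos hα hβ).ne'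
      · exact absurd h hpos.ne'
    have him : ((φ x).im - β) * ((φ x).im + α) ≤ 0 := by
      have := hns.1
      rw [hRre, div_nonpos_iff] at this
      rcases this with h | h
      · linarith [h.2]
      · rw [hre] at h; linarith [h.1]
    have hx' : x = z + (φ x).im • n := by
      have h := eq_inner_smul_add hu (x - z)
      rw [show inner ℝ (x - z) u = (φ x).re from rfl, hre, zero_smul, zero_add] at h
      rw [← sub_eq_iff_eq_add'.1 h]
    refine hxC ⟨hre, ?_⟩
    rcases le_total 0 (φ x).im with h | h
    · rw [hx']
      exact hβs _ ⟨h, by nlinarith⟩ (hx' ▸ hx)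
    · have hx'' : x = z + (-(φ x).im) • -n := by rw [smul_neg, neg_smul, neg_neg]; exact hx'
      rw [hx'']
      exact hαs _ ⟨by linarith, by nlinarith⟩ (hx'' ▸ hx)
  -- The difference of the two logarithms is constant on connected sets off the chord, whereas at z
  -- only the principal one jumps, by 2πi.
  set G : Plane → ℂ := fun x => L x - log (R x) with hG
  have hGc : ∀ {S : Set Plane}, S ⊆ K → Disjoint S (chord K z u) → ContinuousOn G S :=
    fun hSK hd => (hL.mono hSK).sub ((hRc.mono hSK).clog fun x hx =>
      hslit x (hSK hx) (disjoint_left.1 hd hx))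
  have hGe : ∀ x ∈ K, exp (G x) = 1 := fun x hx => by
    have h : R x ≠ 0 := div_ne_zero (hnum x hx) (hden x hx)
    rw [hG, exp_sub, exp_log h, hLe x hx, hφβ, hφα]
    exact div_self h
  have hline : ∀ t : ℝ, φ (z + t • u) = ⟨t, 0⟩ := fun t => by
    apply Complex.ext <;> simp [hφ, inner_smul_left, hu, hun]
  have hoff : ∀ t : ℝ, t ≠ 0 → z + t • u ∉ chord K z u := fun t ht h => by
    have h1 : (φ (z + t • u)).re = 0 := h.1
    rw [hline] at h1
    exact ht h1
  have hcu : Continuous fun t : ℝ => z + t • u := by fun_prop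
  have hconst : ∀ I : Set ℝ, IsPreconnected I → I ⊆ Icc (-ε) ε → (0 : ℝ) ∉ I → ∀ s ∈ I, ∀ t ∈ I,
      G (z + s • u) = G (z + t • u) := by
    intro I hI hIε h0 s hs t ht
    refine eqOn_of_exp_eq_one (hI.image _ hcu.continuousOn) (hGc ?_ ?_) ?_
      (mem_image_of_mem _ hs) (mem_image_of_mem _ ht)
    · rintro _ ⟨s, hs, rfl⟩; exact hseg s (hIε hs)
    · rw [disjoint_left]
      rintro _ ⟨s, hs, rfl⟩
      exact hoff s fun h => h0 (h ▸ hs)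
    · rintro _ ⟨s, hs, rfl⟩; exact hGe _ (hseg s (hIε hs))
  have hends : G (z + (-ε) • u) = G (z + ε • u) :=
    eqOn_of_exp_eq_one hS (hGc hSK hd) (fun x hx => hGe x (hSK hx)) h₁ h₂
  have hR0 : (R z).re < 0 ∧ (R z).im = 0 := by
    have hz0 : φ z = 0 := by have h := hline 0; rw [zero_smul, add_zero] at h; exact h
    refine ⟨?_, by rw [hRim, hz0]; simp⟩
    rw [hRre, hz0]
    refine div_neg_of_neg_of_pos (by simp; positivity) (normSq_pos.2 ?_)
    have h := hden z hz
    rwa [hz0] at h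
  have hpos : ∀ t : ℝ, t ∈ Icc (-ε) ε → 0 < normSq (φ (z + t • u) - ⟨0, -α⟩) :=
    fun t ht => normSq_pos.2 (hden _ (hseg t ht))
  have hnhds : Icc (-ε) ε ∈ 𝓝 (0 : ℝ) := Icc_mem_nhds (by linarith) hε
  have hRt : ContinuousAt (fun t : ℝ => R (z + t • u)) 0 :=
    (hRc.comp hcu.continuousOn hseg).continuousAt hnhds
  have hLt : Tendsto (fun t : ℝ => L (z + t • u)) (𝓝 0) (𝓝 (L z)) := by
    have := ((hL.comp hcu.continuousOn hseg).continuousAt hnhds).tendsto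
    simpa [Function.comp_def] using this
  have hRt' : Tendsto (fun t : ℝ => R (z + t • u)) (𝓝 0) (𝓝 (R z)) := by
    simpa using hRt.tendsto
  have lim1 : Tendsto (fun t : ℝ => G (z + t • u)) (𝓝[>] 0)
      (𝓝 (L z - (Real.log ‖R z‖ - Real.pi * I))) := by
    refine (hLt.mono_left nhdsWithin_le_nhds).sub
      ((tendsto_log_nhdsWithin_im_neg_of_re_neg_of_im_zero hR0.1 hR0.2).comp ?_)
    refine tendsto_nhdsWithin_iff.2 ⟨hRt'.mono_left nhdsWithin_le_nhds, ?_⟩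
    filter_upwards [Ioc_mem_nhdsGT hε] with t ht
    have htm : t ∈ Icc (-ε) ε := ⟨by linarith [ht.1], ht.2⟩
    change (R (z + t • u)).im < 0
    rw [hRim]
    refine div_neg_of_neg_of_pos ?_ (hpos t htm)
    rw [hline]
    have := ht.1
    simp only
    nlinarith [mul_pos this (add_pos hα hβ)]
  have lim2 : Tendsto (fun t : ℝ => G (z + t • u)) (𝓝[<] 0)
      (𝓝 (L z - (Real.log ‖R z‖ + Real.pi * I))) := by
    refine (hLt.mono_left nhdsWithin_le_nhds).sub
      ((tendsto_log_nhdsWithin_im_nonneg_of_re_neg_of_im_zero hR0.1 hR0.2).comp ?_)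
    refine tendsto_nhdsWithin_iff.2 ⟨hRt'.mono_left nhdsWithin_le_nhds, ?_⟩
    filter_upwards [Ico_mem_nhdsLT (show -ε < 0 by linarith)] with t ht
    have htm : t ∈ Icc (-ε) ε := ⟨ht.1, by linarith [ht.2]⟩
    change 0 ≤ (R (z + t • u)).im
    rw [hRim]
    refine div_nonneg ?_ (hpos t htm).le
    rw [hline]
    have := ht.2
    simp only
    nlinarith [mul_pos (neg_pos.2 this) (add_pos hα hβ)]
  have c1 : Tendsto (fun t : ℝ => G (z + t • u)) (𝓝[>] 0) (𝓝 (G (z + ε • u))) := by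
    refine tendsto_const_nhds.congr' ?_
    filter_upwards [Ioc_mem_nhdsGT hε] with t ht
    exact hconst (Ioc 0 ε) isPreconnected_Ioc (fun s hs => ⟨by linarith [hs.1], hs.2⟩)
      (fun h => lt_irrefl _ h.1) _ (right_mem_Ioc.2 hε) _ ht
  have c2 : Tendsto (fun t : ℝ => G (z + t • u)) (𝓝[<] 0) (𝓝 (G (z + ε • u))) := by
    refine tendsto_const_nhds.congr' ?_
    filter_upwards [Ico_mem_nhdsLT (show -ε < 0 by linarith)] with t ht
    rw [← hends]
    exact hconst (Ico (-ε) 0) isPreconnected_Ico (fun s hs => ⟨hs.1, by linarith [hs.2]⟩)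
      (fun h => lt_irrefl _ h.2) _ (left_mem_Ico.2 (by linarith)) _ ht
  -- S makes G equal on the two sides of z, while the one-sided limits differ by 2πi.
  have e := (tendsto_nhds_unique lim1 c1).trans (tendsto_nhds_unique lim2 c2).symm
  have := congrArg Complex.im e
  simp at this
  linarith [Real.pi_pos]

end

/-! ### Filled triangles and kites, nested chords, guarding chords -/

section

open Filter Topology

/-- The oriented area spanned by two vectors. -/
def cross (w u : Plane) : ℝ := w 0 * u 1 - w 1 * u 0

theorem inner_sq_add_cross_sq {w u : Plane} (hw : ‖w‖ = 1) (hu : ‖u‖ = 1) :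
    inner ℝ w u ^ 2 + cross w u ^ 2 = (1 : ℝ) := by
  have h1 := coord_sq_of_norm_eq_one hw
  have h2 := coord_sq_of_norm_eq_one hu
  rw [inner_eq_coord, cross]
  linear_combination (u 0 * u 0 + u 1 * u 1) * h1 + h2

theorem eq_add_cross_smul {w u : Plane} (h : cross w u ≠ 0) (v x : Plane) :
    x = v + (cross (x - v) u / cross w u) • w + (cross w (x - v) / cross w u) • u := by
  have key : cross w u • x =
      cross w u • v + cross (x - v) u • w + cross w (x - v) • u := by
    ext i
    fin_cases i <;> simp [cross] <;> ring
  have h2 := congrArg (fun y => (cross w u)⁻¹ • y) key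
  simp only [smul_add, smul_smul, inv_mul_cancel₀ h, one_smul] at h2
  rw [div_eq_inv_mul, div_eq_inv_mul]
  exact h2

theorem cross_coord_left {w u : Plane} (v : Plane) (a b : ℝ) :
    cross (v + a • w + b • u - v) u = a * cross w u := by
  simp [cross]; ring

theorem cross_coord_right {w u : Plane} (v : Plane) (a b : ℝ) :
    cross w (v + a • w + b • u - v) = b * cross w u := by
  simp [cross]; ring

theorem dist_add_smul {u : Plane} (hu : ‖u‖ = 1) {t : ℝ} (ht : 0 ≤ t) (x : Plane) :
    dist x (x + t • u) = t := by
  rw [dist_eq_norm, sub_add_cancel_left, norm_neg, norm_smul, hu, mul_one, Real.norm_eq_abs,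
    abs_of_nonneg ht]

theorem inner_le_dist {u : Plane} (hu : ‖u‖ = 1) (x y : Plane) : inner ℝ (y - x) u ≤ dist x y := by
  rw [dist_comm, dist_eq_norm]
  simpa [hu] using real_inner_le_norm (y - x) u

theorem eq_neg_or_inner_gt {w u : Plane} (hw : ‖w‖ = 1) (hu : ‖u‖ = 1) :
    w = -u ∨ -1 < inner ℝ w u := by
  rcases (neg_le_of_abs_le (abs_real_inner_le_norm w u)).eq_or_lt with h | h
  · left
    have h2 : ‖w + u‖ ^ 2 = 0 := by
      rw [norm_add_sq_real, ← h, hw, hu]; norm_num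
    exact eq_neg_of_add_eq_zero_left (norm_eq_zero.1 (pow_eq_zero_iff two_ne_zero |>.1 h2))
  · right; simpa [hw, hu] using h

theorem isPreconnected_ray (z u : Plane) {I : Set ℝ} (hI : IsPreconnected I) :
    IsPreconnected ((fun t : ℝ => z + t • u) '' I) :=
  hI.image _ (by fun_prop)

theorem chord_neg (K : Set Plane) (z u : Plane) : chord K z (-u) = chord K z u := by
  ext x; simp [chord]

theorem self_mem_chord {K : Set Plane} {z : Plane} (hz : z ∈ K) (u : Plane) : z ∈ chord K z u :=
  ⟨by simp, by simpa using hz⟩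

theorem isPreconnected_chord (K : Set Plane) (z u : Plane) :
    IsPreconnected (chord K z u) := by
  refine isPreconnected_of_forall z fun y hy => ?_
  have hsub : segment ℝ z y ⊆ chord K z u := by
    intro x hx
    have h1 : segment ℝ z x ⊆ segment ℝ z y :=
      (convex_segment z y).segment_subset (left_mem_segment ℝ z y) hx
    refine ⟨?_, h1.trans hy.2⟩
    rw [segment_eq_image'] at hx
    obtain ⟨t, -, rfl⟩ := hx
    rw [add_sub_cancel_left, inner_smul_left, hy.1, mul_zero]
  exact ⟨segment ℝ z y, hsub, left_mem_segment ℝ z y, right_mem_segment ℝ z y,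
    (convex_segment z y).isPreconnected⟩

namespace IsFull

variable {K : Set Plane} (hK : IsFull K)
include hK

/-- A region of the plane whose boundary belongs to `K` is contained in `K`. -/
theorem mem_of_level {h : Plane → ℝ} (hc : Continuous h) {R : ℝ} (hR : ∀ x, h x ≤ 0 → ‖x‖ ≤ R)
    (h0 : ∀ x, h x = 0 → x ∈ K) {x : Plane} (hx : h x ≤ 0) : x ∈ K := by
  by_contra hxK
  obtain ⟨R', hR'⟩ := hK.isCompact.isBounded.subset_closedBall 0
  obtain ⟨y, hy⟩ := NormedSpace.exists_lt_norm ℝ Plane (max R R')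
  have hyK : y ∉ K := fun h => by
    have := hR' h
    rw [mem_closedBall_zero_iff] at this
    exact absurd (hy.trans_le this) (by simp)
  have hyh : 0 < h y := not_le.1 fun h => absurd (hy.trans_le (hR y h)) (by simp)
  -- The complement connects x, where h ≤ 0, to a far point y, where h > 0, so it would contain a
  -- zero of h.
  obtain ⟨q, hqK, hq⟩ := hK.compl.intermediate_value hxK hyK hc.continuousOn
    (show (0 : ℝ) ∈ _ from ⟨hx, hyh.le⟩)
  exact hqK (h0 q hq)

theorem mem_of_level_coord {v w u : Plane} (hwu : cross w u ≠ 0) {g : ℝ → ℝ → ℝ}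
    (hg : Continuous fun p : ℝ × ℝ => g p.1 p.2) {M : ℝ}
    (hM : ∀ a b, g a b ≤ 0 → |a| ≤ M ∧ |b| ≤ M)
    (h0 : ∀ a b, g a b = 0 → v + a • w + b • u ∈ K) {a b : ℝ} (hab : g a b ≤ 0) :
    v + a • w + b • u ∈ K := by
  set A : Plane → ℝ := fun x => cross (x - v) u / cross w u with hA
  set B : Plane → ℝ := fun x => cross w (x - v) / cross w u with hB
  have hAc : Continuous A := by unfold A cross; fun_prop
  have hBc : Continuous B := by unfold B cross; fun_prop
  refine hK.mem_of_level (h := fun x => g (A x) (B x)) (hg.comp (hAc.prodMk hBc))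
    (R := ‖v‖ + M * ‖w‖ + M * ‖u‖) (fun x hx => ?_) (fun x hx => ?_) ?_
  · obtain ⟨h1, h2⟩ := hM _ _ hx
    rw [eq_add_cross_smul hwu v x]
    refine norm_add₃_le.trans ?_
    rw [norm_smul, norm_smul]
    gcongr
    · exact h1
    · exact h2
  · rw [eq_add_cross_smul hwu v x]
    exact h0 _ _ hx
  · simp only [hA, hB, cross_coord_left, cross_coord_right, mul_div_cancel_right₀ _ hwu]
    exact hab

/-- The triangle is a sublevel set of the maximum of three affine functions, and its zero level
consists of the three sides. -/
theorem mem_of_triangle {v w u : Plane} (hwu : cross w u ≠ 0) (h₁ : segment ℝ v (v + w) ⊆ K)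
    (h₂ : segment ℝ v (v + u) ⊆ K) (h₃ : segment ℝ (v + w) (v + u) ⊆ K) {a b : ℝ} (ha : 0 ≤ a)
    (hb : 0 ≤ b) (hab : a + b ≤ 1) : v + a • w + b • u ∈ K := by
  refine hK.mem_of_level_coord hwu (g := fun a b => max (max (-a) (-b)) (a + b - 1))
    (by fun_prop) (M := 1) (fun a b h => ?_) (fun a b h => ?_) ?_
  · simp only [max_le_iff] at h
    exact ⟨abs_le.2 ⟨by linarith, by linarith⟩, abs_le.2 ⟨by linarith, by linarith⟩⟩
  · have h' := h.le
    simp only [max_le_iff] at h'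
    obtain ⟨⟨ha, hb⟩, hab⟩ := h'
    rcases max_choice (max (-a) (-b)) (a + b - 1) with h1 | h1
    · rcases max_choice (-a) (-b) with h2 | h2
      · have : a = 0 := by linarith
        subst this
        refine h₂ ⟨1 - b, b, by linarith, by linarith, by ring, by module⟩
      · have : b = 0 := by linarith
        subst this
        refine h₁ ⟨1 - a, a, by linarith, by linarith, by ring, by module⟩
    · obtain rfl : b = 1 - a := by linarith
      exact h₃ ⟨a, 1 - a, by linarith, by linarith, by ring, by module⟩
  · simp only [max_le_iff]
    exact ⟨⟨by linarith, by linarith⟩, by linarith⟩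

/-- In the application w and u have equal length and c is the cosine of their angle, so that s + t c
= 1 and s c + t = 1 are the perpendiculars at the ends of the two arms. They meet at s = t = a, the
far vertex of the kite. -/
theorem mem_of_kite {v w u : Plane} (hwu : cross w u ≠ 0) (h₁ : segment ℝ v (v + w) ⊆ K)
    (h₂ : segment ℝ v (v + u) ⊆ K) {a c : ℝ} (hc₂ : 0 < 1 + c) (hc₁ : c < 1)
    (fa : a * (1 + c) = 1) (h₃ : segment ℝ (v + w) (v + a • w + a • u) ⊆ K)
    (h₄ : segment ℝ (v + u) (v + a • w + a • u) ⊆ K) {s t : ℝ} (hs : 0 ≤ s) (ht : 0 ≤ t)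
    (hs1 : s + t * c ≤ 1) (ht1 : s * c + t ≤ 1) : v + s • w + t • u ∈ K := by
  -- A point of the side s + t c = 1 has parameter t (1 + c) = t / a, counted from the end of the
  -- arm to the far vertex.
  have side : ∀ s t : ℝ, 0 ≤ t → s = 1 - t * c → s * c + t ≤ 1 →
      t * (1 + c) ≤ 1 ∧ t * (1 + c) * a = t ∧ 1 - t * (1 + c) + t * (1 + c) * a = s := by
    intro s t ht hs ht1
    have e : t * (1 + c) * a = t := by linear_combination t * fa
    refine ⟨?_, e, by rw [e, hs]; ring⟩
    have : (t * (1 + c)) * (1 - c) ≤ 1 * (1 - c) := by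
      rw [hs] at ht1
      linarith
    exact le_of_mul_le_mul_right this (by linarith)
  refine hK.mem_of_level_coord hwu
    (g := fun s t => max (max (-s) (-t)) (max (s + t * c - 1) (s * c + t - 1)))
    (by fun_prop) (M := 2 * a) (fun s t h => ?_) (fun s t h => ?_) ?_
  · simp only [max_le_iff] at h
    obtain ⟨⟨hs, ht⟩, hs1, ht1⟩ := h
    have : (s + t) * (1 + c) ≤ 2 * a * (1 + c) := by linarith
    have := le_of_mul_le_mul_right this hc₂
    exact ⟨abs_le.2 ⟨by linarith, by linarith⟩, abs_le.2 ⟨by linarith, by linarith⟩⟩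
  · have h' := h.le
    simp only [max_le_iff] at h'
    obtain ⟨⟨hs, ht⟩, hs1, ht1⟩ := h'
    rcases max_choice (max (-s) (-t)) (max (s + t * c - 1) (s * c + t - 1)) with h1 | h1
    · rcases max_choice (-s) (-t) with h2 | h2
      · obtain rfl : s = 0 := by linarith
        exact h₂ ⟨1 - t, t, by linarith, by linarith, by ring, by module⟩
      · obtain rfl : t = 0 := by linarith
        exact h₁ ⟨1 - s, s, by linarith, by linarith, by ring, by module⟩
    · rcases max_choice (s + t * c - 1) (s * c + t - 1) with h2 | h2
      · obtain ⟨hle, e, e'⟩ := side s t (by linarith) (by linarith) (by linarith)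
        refine h₃ ⟨1 - t * (1 + c), t * (1 + c), by linarith,
          mul_nonneg (by linarith) hc₂.le, by ring, ?_⟩
        calc _ = v + (1 - t * (1 + c) + t * (1 + c) * a) • w + (t * (1 + c) * a) • u := by module
          _ = _ := by rw [e', e]
      · obtain ⟨hle, e, e'⟩ := side t s (by linarith) (by linarith) (by linarith)
        refine h₄ ⟨1 - s * (1 + c), s * (1 + c), by linarith,
          mul_nonneg (by linarith) hc₂.le, by ring, ?_⟩
        calc _ = v + (s * (1 + c) * a) • w + (1 - s * (1 + c) + s * (1 + c) * a) • u := by module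
          _ = _ := by rw [e', e]
  · simp only [max_le_iff]
    exact ⟨⟨by linarith, by linarith⟩, by linarith, by linarith⟩

/-- If the perpendiculars to two sides of an angle, at the same distance from the apex, meet
inside `K`, then the angle can be cut short inside `K`. -/
theorem segment_subset_of_chords_meet {v w u : Plane} (hw : ‖w‖ = 1) (hu : ‖u‖ = 1) {δ : ℝ}
    (hδ : 0 < δ) (h₁ : segment ℝ v (v + δ • w) ⊆ K) (h₂ : segment ℝ v (v + δ • u) ⊆ K) {q : Plane}
    (hq₁ : q ∈ chord K (v + δ • w) w) (hq₂ : q ∈ chord K (v + δ • u) u) :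
    segment ℝ (v + δ • w) (v + δ • u) ⊆ K := by
  have hww : inner ℝ w w = (1 : ℝ) := by rw [real_inner_self_eq_norm_sq, hw, one_pow]
  have huu : inner ℝ u u = (1 : ℝ) := by rw [real_inner_self_eq_norm_sq, hu, one_pow]
  set c : ℝ := inner ℝ w u with hc
  have hcs := inner_sq_add_cross_sq hw hu
  rw [← hc] at hcs
  have e1 : inner ℝ (q - v) w = δ := by
    have := hq₁.1
    rw [← sub_sub, inner_sub_left, inner_smul_left, hww] at this
    simpa [sub_eq_zero] using this
  have e2 : inner ℝ (q - v) u = δ := by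
    have := hq₂.1
    rw [← sub_sub, inner_sub_left, inner_smul_left, huu] at this
    simpa [sub_eq_zero] using this
  by_cases hcr : cross w u = 0
  · rw [hcr] at hcs
    rcases eq_neg_or_inner_gt hw hu with h | h
    · rw [h, inner_neg_right, e2] at e1
      linarith
    · have hc1 : c = 1 := by
        rw [← hc] at h
        have : (c - 1) * (c + 1) = 0 := by linarith
        rcases mul_eq_zero.1 this with h' | h' <;> linarith
      have : w = u := (inner_eq_one_iff_of_norm_eq_one hw hu).1 hc1
      rw [this, segment_same, singleton_subset_iff]
      exact h₂ (right_mem_segment _ _ _)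
  · have hcr2 : 0 < cross w u ^ 2 := by positivity
    have hc1 : c < 1 := by nlinarith
    have hc2 : 0 < 1 + c := by nlinarith
    have hcr' : cross (δ • w) (δ • u) ≠ 0 := by
      have : cross (δ • w) (δ • u) = δ ^ 2 * cross w u := by simp [cross]; ring
      rw [this]; positivity
    obtain ⟨a, b, hqab⟩ : ∃ a b : ℝ, q = v + a • δ • w + b • δ • u :=
      ⟨_, _, eq_add_cross_smul hcr' v q⟩
    have hqv : q - v = a • δ • w + b • δ • u := by rw [hqab]; abel
    rw [hqv, inner_add_left, inner_smul_left, inner_smul_left, inner_smul_left, inner_smul_left,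
      hww, real_inner_comm, ← hc] at e1
    rw [hqv, inner_add_left, inner_smul_left, inner_smul_left, inner_smul_left, inner_smul_left,
      huu, ← hc] at e2
    simp only [conj_trivial, mul_one] at e1 e2
    have f1 : a + b * c = 1 := mul_left_cancel₀ hδ.ne' (by linarith)
    have f2 : a * c + b = 1 := mul_left_cancel₀ hδ.ne' (by linarith)
    -- `q` lies on the bisector of the angle, so the arms and the two chord pieces bound a kite.
    obtain rfl : a = b := by
      have : (a - b) * (1 - c) = 0 := by linarith
      rcases mul_eq_zero.1 this with h | h <;> linarith
    have fa : a * (1 + c) = 1 := by linarith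
    rintro _ ⟨s, t, hs, ht, hst, rfl⟩
    have := hK.mem_of_kite hcr' h₁ h₂ hc2 hc1 fa (hqab ▸ hq₁.2) (hqab ▸ hq₂.2) hs ht
      (by nlinarith) (by nlinarith)
    convert this using 1
    obtain rfl : t = 1 - s := by linarith
    module

end IsFull

/-- `y` is on the rear side of the chord through `z` perpendicular to `u`. -/
def Behind (K : Set Plane) (z u y : Plane) : Prop :=
  ∃ ε : ℝ, 0 < ε ∧ (∀ t ∈ Icc (-ε) 0, z + t • u ∈ K) ∧ ∃ S ⊆ K, IsPreconnected S ∧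
    Disjoint S (chord K z u) ∧ z + (-ε) • u ∈ S ∧ y ∈ S

theorem Behind.of_isPreconnected {K : Set Plane} {z u x y : Plane} (h : Behind K z u x)
    {S : Set Plane} (hS : IsPreconnected S) (hSK : S ⊆ K) (hd : Disjoint S (chord K z u))
    (hx : x ∈ S) (hy : y ∈ S) : Behind K z u y := by
  obtain ⟨ε, hε, hseg, S', hS'K, hS', hd', hz, hx'⟩ := h
  exact ⟨ε, hε, hseg, S' ∪ S, union_subset hS'K hSK, hS'.union x hx' hx hS,
    hd'.union_left hd, Or.inl hz, Or.inr hy⟩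

/-- No point behind a chord is connected to a point before it without crossing it. -/
theorem IsFull.not_behind {K : Set Plane} (hK : IsFull K) {z u y : Plane} (hu : ‖u‖ = 1) {ℓ : ℝ}
    (hℓ : 0 < ℓ) (hseg : ∀ t ∈ Icc 0 ℓ, z + t • u ∈ K) {S : Set Plane} (hS : IsPreconnected S)
    (hSK : S ⊆ K) (hd : Disjoint S (chord K z u)) (h : z + ℓ • u ∈ S) (hy : y ∈ S) :
    ¬ Behind K z u y := by
  rintro ⟨ε, hε, hsegε, S', hS'K, hS', hd', hz, hy'⟩
  have hoff : ∀ t : ℝ, t ≠ 0 → z + t • u ∉ chord K z u := fun t ht hc => ht (by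
    simpa [inner_smul_left, hu] using hc.1)
  -- `chord_separates` needs the same distance on both sides of z; the straight pieces `A` and `B`
  -- make up the difference.
  set η := min ε ℓ with hη
  have hη0 : 0 < η := lt_min hε hℓ
  have hηε : η ≤ ε := min_le_left _ _
  have hηℓ : η ≤ ℓ := min_le_right _ _
  set A : Set Plane := (fun t : ℝ => z + t • u) '' Icc (-ε) (-η)
  set B : Set Plane := (fun t : ℝ => z + t • u) '' Icc η ℓ
  have hA : IsPreconnected A := isPreconnected_ray z u isPreconnected_Icc
  have hB : IsPreconnected B := isPreconnected_ray z u isPreconnected_Icc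
  have h1 : IsPreconnected (A ∪ (S' ∪ (S ∪ B))) :=
    hA.union (z + (-ε) • u) ⟨-ε, ⟨le_rfl, by linarith⟩, rfl⟩ (Or.inl hz)
      (hS'.union y hy' (Or.inl hy) (hS.union (z + ℓ • u) h ⟨ℓ, ⟨hηℓ, le_rfl⟩, rfl⟩ hB))
  refine hK.chord_separates hu hη0 (fun t ht => ?_) h1 ?_ ?_
    (Or.inl ⟨-η, ⟨by linarith, le_rfl⟩, rfl⟩)
    (Or.inr (Or.inr (Or.inr ⟨η, ⟨le_rfl, hηℓ⟩, rfl⟩)))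
  · rcases le_total t 0 with h | h
    · exact hsegε t ⟨by linarith [ht.1], h⟩
    · exact hseg t ⟨h, by linarith [ht.2]⟩
  · refine union_subset ?_ (union_subset hS'K (union_subset hSK ?_))
    · rintro _ ⟨t, ht, rfl⟩; exact hsegε t ⟨ht.1, by linarith [ht.2]⟩
    · rintro _ ⟨t, ht, rfl⟩; exact hseg t ⟨by linarith [ht.1], ht.2⟩
  · refine Disjoint.union_left ?_ (hd'.union_left (hd.union_left ?_)) <;> rw [disjoint_left]
    · rintro _ ⟨t, ht, rfl⟩; exact hoff t (by linarith [ht.2])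
    · rintro _ ⟨t, ht, rfl⟩; exact hoff t (by linarith [ht.1])

/-- Successive disjoint chords are nested. -/
theorem IsFull.behind_of_behind {K : Set Plane} (hK : IsFull K) {z p z' u u' y : Plane}
    (hu : ‖u‖ = 1) (hu' : ‖u'‖ = 1) {ℓ ℓ' : ℝ} (hℓ : 0 < ℓ) (hℓ' : 0 < ℓ') (hp : p = z + ℓ • u)
    (hz' : z' = p + ℓ' • u') (h₁ : ∀ t ∈ Icc 0 ℓ, z + t • u ∈ K)
    (h₂ : ∀ t ∈ Icc 0 ℓ', p + t • u' ∈ K) (hc₁ : 0 < ℓ + ℓ' * inner ℝ u u')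
    (hc₂ : 0 < ℓ' + ℓ * inner ℝ u u') (hd : Disjoint (chord K z u) (chord K z' u'))
    (hy : y ∈ chord K z u ∨ Behind K z u y) : Behind K z' u' y := by
  have huu : inner ℝ u u = (1 : ℝ) := by rw [real_inner_self_eq_norm_sq, hu, one_pow]
  have huu' : inner ℝ u' u' = (1 : ℝ) := by rw [real_inner_self_eq_norm_sq, hu', one_pow]
  set c : ℝ := inner ℝ u u' with hc
  have hzK : z ∈ K := by simpa using h₁ 0 ⟨le_rfl, hℓ.le⟩
  have hz'K : z' ∈ K := hz' ▸ h₂ ℓ' ⟨hℓ'.le, le_rfl⟩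
  have hback : ∀ t ∈ Icc (-ℓ') 0, z' + t • u' ∈ K := fun t ht => by
    have : z' + t • u' = p + (ℓ' + t) • u' := by rw [hz']; module
    rw [this]; exact h₂ _ ⟨by linarith [ht.1], by linarith [ht.2]⟩
  have hzp : z' + (-ℓ') • u' = p := by rw [hz']; module
  set A : Set Plane := (fun t : ℝ => z + t • u) '' Icc 0 ℓ with hA
  have hAc : IsPreconnected A := isPreconnected_ray z u isPreconnected_Icc
  have hAK : A ⊆ K := by rintro _ ⟨t, ht, rfl⟩; exact h₁ t ht
  -- The component along `u'`, measured from `z'`, is (t - ℓ) c - ℓ', which is negative on the first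
  -- leg by `hc₂`. Likewise `hc₁` keeps the second leg off the first chord.
  have hAd : Disjoint A (chord K z' u') := by
    rw [disjoint_left]
    rintro _ ⟨t, ht, rfl⟩ h
    have h1 := h.1
    simp only [hz', hp] at h1
    rw [show z + t • u - (z + ℓ • u + ℓ' • u') = (t - ℓ) • u - ℓ' • u' by module, inner_sub_left,
      inner_smul_left, inner_smul_left, huu', ← hc] at h1
    simp only [conj_trivial] at h1
    have := ht.1
    have := ht.2
    rcases le_total 0 c with h | h <;> nlinarith
  have hzA : z ∈ A := ⟨0, ⟨le_rfl, hℓ.le⟩, by simp⟩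
  have hpA : p ∈ A := ⟨ℓ, ⟨hℓ.le, le_rfl⟩, hp.symm⟩
  rcases hy with hy | hy
  · refine ⟨ℓ', hℓ', hback, A ∪ chord K z u, union_subset hAK (chord_subset _ _ _),
      hAc.union z hzA (self_mem_chord hzK u) (isPreconnected_chord K z u), hAd.union_left hd, ?_,
      Or.inr hy⟩
    rw [hzp]; exact Or.inl hpA
  · have hy' := hy
    obtain ⟨ε, hε, hsegε, S, hSK, hS, hSd, hz, hyS⟩ := hy
    -- Time 0 is left out because z itself is on the first chord.
    set E : Set Plane := (fun t : ℝ => z + t • u) '' Ico (-ε) 0 with hE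
    have hEK : E ⊆ K := by rintro _ ⟨t, ht, rfl⟩; exact hsegε t ⟨ht.1, ht.2.le⟩
    have hEd : Disjoint E (chord K z u) := by
      rw [disjoint_left]
      rintro _ ⟨t, ht, rfl⟩ h
      exact ht.2.ne (by simpa [inner_smul_left, hu] using h.1)
    have hSE : IsPreconnected (S ∪ E) :=
      hS.union _ hz ⟨-ε, ⟨le_rfl, by linarith⟩, rfl⟩ (isPreconnected_ray z u isPreconnected_Ico)
    by_cases hmeet : Disjoint (S ∪ E) (chord K z' u')
    · set F : Set Plane := (fun t : ℝ => z + t • u) '' Icc (-ε) ℓ with hF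
      have hFsub : F ⊆ E ∪ A := by
        rintro _ ⟨t, ht, rfl⟩
        rcases lt_or_ge t 0 with h | h
        · exact Or.inl ⟨t, ⟨ht.1, h⟩, rfl⟩
        · exact Or.inr ⟨t, ⟨h, ht.2⟩, rfl⟩
      refine ⟨ℓ', hℓ', hback, S ∪ F, union_subset hSK (hFsub.trans (union_subset hEK hAK)),
        hS.union _ hz ⟨-ε, ⟨le_rfl, by linarith⟩, rfl⟩ (isPreconnected_ray z u isPreconnected_Icc),
        ?_, ?_, Or.inl hyS⟩
      · rw [disjoint_union_left] at hmeet
        exact hmeet.1.union_left ((hmeet.2.union_left hAd).mono_left hFsub)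
      · rw [hzp]; exact Or.inr ⟨ℓ, ⟨by linarith, le_rfl⟩, hp.symm⟩
    -- If the rear side of the first chord reached the second chord, one could go on along it to z'
    -- and back along the second leg to p, which is in front of the first chord.
    · exfalso
      obtain ⟨q, hq, hq'⟩ := not_disjoint_iff.1 hmeet
      set B : Set Plane := (fun t : ℝ => p + t • u') '' Icc 0 ℓ' with hB
      have hBd : Disjoint B (chord K z u) := by
        rw [disjoint_left]
        rintro _ ⟨t, ht, rfl⟩ h
        have h1 := h.1
        simp only [hp] at h1
        rw [show z + ℓ • u + t • u' - z = ℓ • u + t • u' by module, inner_add_left,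
          inner_smul_left, inner_smul_left, huu, real_inner_comm, ← hc] at h1
        simp only [conj_trivial] at h1
        have := ht.1
        have := ht.2
        rcases le_total 0 c with h | h <;> nlinarith
      have hBK : B ⊆ K := by rintro _ ⟨t, ht, rfl⟩; exact h₂ t ht
      have hconn : IsPreconnected ((S ∪ E) ∪ (chord K z' u' ∪ B)) :=
        hSE.union q hq (Or.inl hq') ((isPreconnected_chord K z' u').union z'
          (self_mem_chord hz'K u') ⟨ℓ', ⟨hℓ'.le, le_rfl⟩, hz'.symm⟩
          (isPreconnected_ray p u' isPreconnected_Icc))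
      refine hK.not_behind hu hℓ h₁ hconn ?_ ?_ ?_ (Or.inl (Or.inl hyS)) hy'
      · exact union_subset (union_subset hSK hEK) (union_subset (chord_subset _ _ _) hBK)
      · exact (hSd.union_left hEd).union_left (hd.symm.union_left hBd)
      · exact Or.inr (Or.inr ⟨0, ⟨le_rfl, hℓ'.le⟩, by simpa using hp⟩)

/-- The chord through `z` perpendicular to `u` separates the points behind it from `T`, and has
distance at least `ρ` from `T`. -/
def Guards (K T : Set Plane) (z u : Plane) (ρ : ℝ) : Prop :=
  (∀ y ∈ T, y ∉ chord K z u ∧ ¬ Behind K z u y) ∧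
    ∀ q ∈ chord K z u, ∀ y ∈ T, ρ ≤ geodesicDist K q y

theorem Guards.mono {K T : Set Plane} {z u : Plane} {ρ ρ' : ℝ} (h : Guards K T z u ρ)
    (hρ : ρ' ≤ ρ) : Guards K T z u ρ' :=
  ⟨h.1, fun q hq y hy => hρ.trans (h.2 q hq y hy)⟩

/-- Passing a bend at scale δ costs 2δ in the bound; letting δ tend to 0 recovers the loss. -/
theorem guards_of_forall_lt {K T : Set Plane} {z u : Plane} {ρ η : ℝ} (hη : 0 < η)
    (h : ∀ δ, 0 < δ → δ < η → Guards K T z u (ρ - 2 * δ)) : Guards K T z u ρ := by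
  refine ⟨(h (η / 2) (by linarith) (by linarith)).1, fun q hq y hy => ?_⟩
  refine le_of_forall_pos_le_add fun e he => ?_
  have h1 : 0 < min e η := lt_min he hη
  have := (h (min e η / 2) (by linarith) (by linarith [min_le_right e η])).2 q hq y hy
  linarith [min_le_left e η]

namespace IsFull

variable {K : Set Plane} (hK : IsFull K)
include hK

/-- A path from behind the chord to T crosses it at some q: it is at least `m` long before q and at
least `ρ` long after q. -/
theorem add_le_geodesicDist {T : Set Plane} (hT : T ⊆ K) {z u : Plane} {ρ : ℝ}
    (h : Guards K T z u ρ) {x y : Plane} (hxK : x ∈ K) (hx : Behind K z u x) (hy : y ∈ T) {m : ℝ}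
    (hm : ∀ q ∈ chord K z u, m ≤ dist x q) : m + ρ ≤ geodesicDist K x y := by
  refine hK.le_geodesicDist hxK (hT hy) fun S hSK hS hxS hyS => ?_
  by_cases hd : Disjoint S (chord K z u)
  · exact absurd (hx.of_isPreconnected hS hSK hd hxS hyS) (h.1 y hy).2
  · obtain ⟨q, hqS, hq⟩ := not_disjoint_iff.1 hd
    exact ⟨q, hqS, add_le_add ((hm q hq).trans (hK.dist_le hxK (hSK hqS))) (h.2 q hq y hy)⟩

/-- The two chords are parallel at distance t, hence disjoint and nested, and a path from the rear
chord to T must cross the strip between them. -/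
theorem guards_straight {T : Set Plane} (hT : T ⊆ K) {z u : Plane} (hu : ‖u‖ = 1) {ρ t : ℝ}
    (ht : 0 < t) (hseg : ∀ s ∈ Icc 0 t, z + s • u ∈ K) (h : Guards K T (z + t • u) u ρ) :
    Guards K T z u (t + ρ) := by
  have huu : inner ℝ u u = (1 : ℝ) := by rw [real_inner_self_eq_norm_sq, hu, one_pow]
  have hdist : ∀ q ∈ chord K z u, ∀ q' ∈ chord K (z + t • u) u, t ≤ dist q q' := by
    intro q hq q' hq'
    refine le_trans (le_of_eq ?_) (inner_le_dist hu q q')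
    have h1 := hq.1
    have h2 := hq'.1
    rw [← sub_sub, inner_sub_left, inner_smul_left, huu] at h2
    rw [show q' - q = (q' - z) - (q - z) by abel, inner_sub_left, h1]
    simp at h2 ⊢
    linarith
  have hnest : ∀ y, y ∈ chord K z u ∨ Behind K z u y → Behind K (z + t • u) u y := fun y hy =>
    -- The straight piece is halved because the nesting lemma needs two legs of positive length.
    hK.behind_of_behind hu hu (half_pos ht) (half_pos ht) rfl (by module)
      (fun s hs => hseg s ⟨hs.1, by linarith [hs.2]⟩)
      (fun s hs => by
        rw [add_assoc, ← add_smul]; exact hseg _ ⟨by linarith [hs.1], by linarith [hs.2]⟩)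
      (by rw [huu]; linarith) (by rw [huu]; linarith)
      (disjoint_left.2 fun q hq hq' => by
        have := hdist q hq q hq'
        rw [dist_self] at this
        linarith) hy
  refine ⟨fun y hy => ⟨fun hc => (h.1 y hy).2 (hnest y (Or.inl hc)),
    fun hb => (h.1 y hy).2 (hnest y (Or.inr hb))⟩, fun q hq y hy => ?_⟩
  exact hK.add_le_geodesicDist hT h (chord_subset _ _ _ hq) (hnest q (Or.inl hq)) hy (hdist q hq)

/-- If the chords on the two sides of the corner met, `segment_subset_of_chords_meet` would join the
ends of the arms inside K. So they are nested, and the bound is carried over without gain. -/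
theorem guards_turn {T : Set Plane} (hT : T ⊆ K) {v w u : Plane} (hw : ‖w‖ = 1) (hu : ‖u‖ = 1)
    {ρ δ : ℝ} (hδ : 0 < δ) (h₁ : ∀ s ∈ Icc 0 δ, v + s • w ∈ K) (h₂ : ∀ s ∈ Icc 0 δ, v + s • u ∈ K)
    (hns : ¬ segment ℝ (v + δ • w) (v + δ • u) ⊆ K) (h : Guards K T (v + δ • u) u ρ) :
    Guards K T (v + δ • w) (-w) ρ := by
  have hw' : ‖-w‖ = 1 := by rwa [norm_neg]
  have hne : -w ≠ -u := fun e => hns (by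
    rw [neg_inj.1 e, segment_same, singleton_subset_iff]; exact h₂ δ ⟨hδ.le, le_rfl⟩)
  have hc : -1 < inner ℝ (-w) u := (eq_neg_or_inner_gt hw' hu).resolve_left hne
  have hnest : ∀ y, y ∈ chord K (v + δ • w) (-w) ∨ Behind K (v + δ • w) (-w) y →
      Behind K (v + δ • u) u y := fun y hy =>
    hK.behind_of_behind hw' hu hδ hδ (p := v) (by module) rfl
      (fun s hs => by
        rw [show v + δ • w + s • -w = v + (δ - s) • w by module]
        exact h₁ _ ⟨by linarith [hs.2], by linarith [hs.1]⟩)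
      h₂ (by nlinarith) (by nlinarith)
      (disjoint_left.2 fun q hq hq' => hns (hK.segment_subset_of_chords_meet hw hu hδ
        ((segment_ray_subset_iff hδ.le).2 h₁) ((segment_ray_subset_iff hδ.le).2 h₂)
        (by rwa [chord_neg] at hq) hq')) hy
  refine ⟨fun y hy => ⟨fun hc => (h.1 y hy).2 (hnest y (Or.inl hc)),
    fun hb => (h.1 y hy).2 (hnest y (Or.inr hb))⟩, fun q hq y hy => ?_⟩
  have := hK.add_le_geodesicDist hT h (chord_subset _ _ _ hq) (hnest q (Or.inl hq)) hy
    (m := 0) (fun _ _ => dist_nonneg)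
  linarith

/-- The induction starts here. If the perpendicular at z met T in y, the right triangle v, z, y
would lie in K, and the foot of its altitude from z would be a point of T closer to z than δ. Hence
T misses the chord; being connected and containing v, it lies in front of it. -/
theorem guards_last {T : Set Plane} (hT : T ⊆ K) (hconv : Convex ℝ T) {v w : Plane} (hv : v ∈ T)
    (hw : ‖w‖ = 1) {δ : ℝ} (hδ : 0 < δ) (hseg : ∀ s ∈ Icc 0 δ, v + s • w ∈ K)
    (hmin : ∀ y ∈ T, δ ≤ geodesicDist K (v + δ • w) y) : Guards K T (v + δ • w) (-w) 0 := by
  set z := v + δ • w with hz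
  have hw' : ‖-w‖ = 1 := by rwa [norm_neg]
  have hzK : z ∈ K := hseg δ ⟨hδ.le, le_rfl⟩
  have hout : ∀ y ∈ T, y ∉ chord K z (-w) := by
    intro y hy hyc
    rw [chord_neg] at hyc
    obtain ⟨hin, hzy⟩ := hyc
    set U := y - z with hU
    have hzU : z + U = y := by rw [hU]; abel
    set M := ‖U‖ with hM
    have hM0 : 0 < M := by
      refine norm_pos_iff.2 fun h => ?_
      have h1 := hmin y hy
      rw [← hzU, h, add_zero, hK.geodesicDist_self hzK] at h1
      linarith
    have hcr : cross (-δ • w) U ≠ 0 := by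
      have hl : inner ℝ U w ^ 2 + cross w U ^ 2 = ‖U‖ ^ 2 := by
        have h1 := coord_sq_of_norm_eq_one hw
        rw [← real_inner_self_eq_norm_sq, inner_eq_coord, inner_eq_coord, cross]
        linear_combination (U 0 * U 0 + U 1 * U 1) * h1
      rw [hin] at hl
      have h2 : cross w U ≠ 0 := fun h => by
        rw [h] at hl
        have : ‖U‖ ^ 2 = 0 := by linarith
        exact hM0.ne' (pow_eq_zero_iff two_ne_zero |>.1 this)
      have h3 : cross (-δ • w) U = -δ * cross w U := by simp [cross]; ring
      rw [h3]
      exact mul_ne_zero (neg_ne_zero.2 hδ.ne') h2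
    have hzv : z + -δ • w = v := by rw [hz]; module
    set N := δ ^ 2 + M ^ 2 with hN
    have hN0 : 0 < N := by positivity
    have htri : ∀ t ∈ Icc (0 : ℝ) 1,
        z + (t * (M ^ 2 / N)) • (-δ • w) + (t * (δ ^ 2 / N)) • U ∈ K := by
      intro t ht
      refine hK.mem_of_triangle hcr ?_ (by rwa [hzU]) ?_ (mul_nonneg ht.1 (by positivity))
        (mul_nonneg ht.1 (by positivity)) ?_
      · rw [hzv, segment_symm]
        exact (segment_ray_subset_iff hδ.le).2 hseg
      · rw [hzv, hzU]
        exact (hconv.segment_subset hv hy).trans hT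
      · rw [← mul_add, ← add_div, add_comm (M ^ 2), div_self hN0.ne', mul_one]
        exact ht.2
    -- The altitude vector of the right triangle with legs δ and M; its squared length δ² M² / (δ² +
    -- M²) is less than δ².
    set V := (M ^ 2 / N) • (-δ • w) + (δ ^ 2 / N) • U with hV
    have hfT : z + V ∈ T := by
      refine hconv.segment_subset hv hy ⟨M ^ 2 / N, δ ^ 2 / N, by positivity, by positivity, ?_, ?_⟩
      · rw [← add_div, add_comm (M ^ 2), div_self hN0.ne']
      · have : M ^ 2 / N + δ ^ 2 / N = 1 := by
          rw [← add_div, add_comm (M ^ 2), div_self hN0.ne']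
        rw [hV, ← hzv, ← hzU]
        have e : z = (M ^ 2 / N + δ ^ 2 / N) • z := by rw [this, one_smul]
        calc _ = (M ^ 2 / N + δ ^ 2 / N) • z + (M ^ 2 / N) • (-δ • w) + (δ ^ 2 / N) • U := by module
          _ = _ := by rw [← e, add_assoc]
    have hzf : segment ℝ z (z + V) ⊆ K := by
      rw [segment_eq_image']
      rintro _ ⟨t, ht, rfl⟩
      convert htri t ht using 1
      rw [hV]; module
    have h1 := hmin _ hfT
    rw [hK.geodesicDist_eq_dist hzf, dist_eq_norm, sub_add_cancel_left, norm_neg] at h1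
    have h2 : ‖V‖ ^ 2 = δ ^ 2 * M ^ 2 / N := by
      rw [hV, norm_add_sq_real, norm_smul, norm_smul, norm_smul, hw, ← hM, inner_smul_left,
        inner_smul_left, inner_smul_right, real_inner_comm, hin]
      simp only [Real.norm_eq_abs, abs_neg, mul_one, mul_zero, add_zero]
      rw [abs_of_pos hδ, abs_of_nonneg (by positivity), abs_of_nonneg (by positivity)]
      field_simp
      rw [hN]; ring
    have h3 : δ ^ 2 ≤ ‖V‖ ^ 2 := pow_le_pow_left₀ hδ.le h1 2
    rw [h2, le_div_iff₀ hN0, hN] at h3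
    nlinarith [pow_pos hδ 4]
  refine ⟨fun y hy => ⟨hout y hy, ?_⟩, fun q hq y hy => geodesicDist_nonneg _ _ _⟩
  refine hK.not_behind (ℓ := δ) hw' hδ (fun t ht => ?_) hconv.isPreconnected hT
    (disjoint_left.2 hout) ?_ hy
  · rw [hz, show v + δ • w + t • -w = v + (δ - t) • w by module]
    exact hseg _ ⟨by linarith [ht.2], by linarith [ht.1]⟩
  · rw [hz, show v + δ • w + δ • -w = v by module]
    exact hv

end IsFull

end

/-! ### Guards along a geodesic, local support, shortest paths -/

section

open Filter Topology

theorem IsUnitGeodesic.reverse {K : Set Plane} {σ : ℝ → Plane} {ℓ : ℝ} (h : IsUnitGeodesic K σ ℓ) :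
    IsUnitGeodesic K (fun t => σ (ℓ - t)) ℓ := by
  refine ⟨fun t ht => h.1 ⟨by linarith [ht.2], by linarith [ht.1]⟩, fun s hs t ht hst => ?_⟩
  rw [geodesicDist_comm, h.2 _ ⟨by linarith [ht.2], by linarith [ht.1]⟩ _
    ⟨by linarith [hs.2], by linarith [hs.1]⟩ (by linarith)]
  ring

namespace IsFull

variable {K : Set Plane} (hK : IsFull K)
include hK

/-- Near σ s the geodesic distance from σ s is Euclidean, so the triangle inequality for σ s, σ (s +
t), σ (s + r) is an equality in the plane and the three points are in line. -/
theorem exists_straight_right {σ : ℝ → Plane} {ℓ s : ℝ} (hσ : IsUnitGeodesic K σ ℓ) (h0 : 0 ≤ s)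
    (hs : s < ℓ) : ∃ r > 0, ∃ u : Plane, ‖u‖ = 1 ∧ s + r ≤ ℓ ∧
      ∀ t ∈ Icc 0 r, σ (s + t) = σ s + t • u := by
  obtain ⟨r₀, hr₀, hstar⟩ := hK.star (σ s) (hσ.1 ⟨h0, hs.le⟩)
  set r := min (r₀ / 2) (ℓ - s) with hr
  have hr1 : r ≤ r₀ / 2 := min_le_left _ _
  have hr2 : r ≤ ℓ - s := min_le_right _ _
  have hr0 : 0 < r := lt_min (by linarith) (by linarith)
  have hmem : ∀ t ∈ Icc 0 r, s + t ∈ Icc 0 ℓ := fun t ht => ⟨by linarith [ht.1], by linarith [ht.2]⟩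
  have hdist : ∀ t ∈ Icc 0 r, dist (σ s) (σ (s + t)) = t := by
    intro t ht
    have h1 : geodesicDist K (σ s) (σ (s + t)) = t := by
      rw [hσ.2 s ⟨h0, hs.le⟩ _ (hmem t ht) (by linarith [ht.1])]; ring
    have h2 := hK.dist_le (hσ.1 ⟨h0, hs.le⟩) (hσ.1 (hmem t ht))
    rw [← hK.geodesicDist_eq_dist (hstar _ (hσ.1 (hmem t ht)) (by linarith [ht.2])), h1]
  have hrr : r ∈ Icc 0 r := ⟨hr0.le, le_rfl⟩
  refine ⟨r, hr0, r⁻¹ • (σ (s + r) - σ s), ?_, by linarith, fun t ht => ?_⟩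
  · rw [norm_smul, ← dist_eq_norm, dist_comm, hdist r hrr, Real.norm_eq_abs, abs_inv,
      abs_of_pos hr0, inv_mul_cancel₀ hr0.ne']
  · have h1 := hdist t ht
    have h2 := hdist r hrr
    have h3 : dist (σ (s + t)) (σ (s + r)) ≤ r - t := by
      refine (hK.dist_le (hσ.1 (hmem t ht)) (hσ.1 (hmem r hrr))).trans (le_of_eq ?_)
      rw [hσ.2 _ (hmem t ht) _ (hmem r hrr) (by linarith [ht.2])]; ring
    have h4 : Wbtw ℝ (σ s) (σ (s + t)) (σ (s + r)) := by
      rw [← dist_add_dist_eq_iff]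
      linarith [dist_triangle (σ s) (σ (s + t)) (σ (s + r))]
    obtain ⟨k, hk, hk'⟩ := h4
    have h5 : k * r = t := by
      rw [← hk', dist_left_lineMap, h2, Real.norm_eq_abs, abs_of_nonneg hk.1] at h1
      exact h1
    rw [← hk', AffineMap.lineMap_apply, vsub_eq_sub, vadd_eq_add, add_comm, smul_smul, ← h5,
      mul_assoc, mul_inv_cancel₀ hr0.ne', mul_one]

theorem exists_straight_left {σ : ℝ → Plane} {ℓ s : ℝ} (hσ : IsUnitGeodesic K σ ℓ) (h0 : 0 < s)
    (hs : s ≤ ℓ) : ∃ r > 0, ∃ w : Plane, ‖w‖ = 1 ∧ r ≤ s ∧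
      ∀ t ∈ Icc 0 r, σ (s - t) = σ s + t • w := by
  obtain ⟨r, hr, w, hw, hrs, h⟩ := hK.exists_straight_right hσ.reverse (s := ℓ - s)
    (by linarith) (by linarith)
  refine ⟨r, hr, w, hw, by linarith, fun t ht => ?_⟩
  have := h t ht
  rwa [show ℓ - (ℓ - s + t) = s - t by ring, sub_sub_cancel] at this

/-- The perpendicular chords along a geodesic to a nearest point of `T` guard `T`. -/
theorem guards_of_isUnitGeodesic {T : Set Plane} (hT : T ⊆ K) (hconv : Convex ℝ T)
    {σ : ℝ → Plane} {D : ℝ} (hσ : IsUnitGeodesic K σ D) (hD : σ D ∈ T)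
    (hmin : ∀ t ∈ Icc 0 D, ∀ y ∈ T, D - t ≤ geodesicDist K (σ t) y) {τ ε : ℝ} {u : Plane}
    (h0τ : 0 < τ) (hτD : τ < D) (hε : 0 < ε) (hu : ‖u‖ = 1)
    (hstr : ∀ t ∈ Icc (-ε) ε, σ (τ + t) = σ τ + t • u) : Guards K T (σ τ) u (D - τ) := by
  let P : ℝ → Prop := fun τ => ∀ ε > 0, ∀ u : Plane, ‖u‖ = 1 →
    (∀ t ∈ Icc (-ε) ε, σ (τ + t) = σ τ + t • u) → Guards K T (σ τ) u (D - τ)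
  -- Backward continuous induction from D: were the infimum `s₀` of `G` positive, the guards would
  -- extend past it to `s₀ - r`.
  set G : Set ℝ := {s | s ∈ Icc 0 D ∧ ∀ τ ∈ Ioo s D, P τ} with hG
  have hD0 : 0 ≤ D := h0τ.le.trans hτD.le
  have hDG : D ∈ G := ⟨⟨hD0, le_rfl⟩, fun τ hτ => absurd (hτ.1.trans hτ.2) (lt_irrefl _)⟩
  have hbdd : BddBelow G := ⟨0, fun s hs => hs.1.1⟩
  set s₀ := sInf G with hs₀
  have hs₀0 : 0 ≤ s₀ := le_csInf ⟨D, hDG⟩ fun s hs => hs.1.1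
  have hs₀D : s₀ ≤ D := csInf_le hbdd hDG
  have hs₀P : ∀ τ ∈ Ioo s₀ D, P τ := by
    intro τ hτ
    obtain ⟨s, hs, hsτ⟩ := exists_lt_of_csInf_lt ⟨D, hDG⟩ hτ.1
    exact hs.2 τ ⟨hsτ, hτ.2⟩
  rcases hs₀0.eq_or_lt with h | hpos
  · exact hs₀P τ ⟨by rwa [← h], hτD⟩ ε hε u hu hstr
  exfalso
  set v := σ s₀ with hv
  obtain ⟨r, hr, w, hw, hrs, hleft⟩ := hK.exists_straight_left hσ hpos hs₀D
  have hwK : ∀ t ∈ Icc 0 r, v + t • w ∈ K := fun t ht => by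
    rw [← hleft t ht]; exact hσ.1 ⟨by linarith [ht.2], by linarith [ht.1]⟩
  -- It suffices to guard points just before `v`.
  have key : ∃ η > 0, ∀ δ, 0 < δ → δ < η → Guards K T (v + δ • w) (-w) (D - s₀ - δ) := by
    rcases hs₀D.eq_or_lt with h | hlt
    · refine ⟨r, hr, fun δ hδ hδr => ?_⟩
      refine (hK.guards_last hT hconv (by rw [hv, h]; exact hD) hw hδ
        (fun t ht => hwK t ⟨ht.1, ht.2.trans hδr.le⟩) fun y hy => ?_).mono (by linarith)
      rw [← hleft δ ⟨hδ.le, hδr.le⟩]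
      have := hmin (s₀ - δ) ⟨by linarith, by linarith⟩ y hy
      linarith
    · obtain ⟨r', hr', u', hu', hrs', hright⟩ := hK.exists_straight_right hσ hs₀0 hlt
      have hu'K : ∀ t ∈ Icc 0 r', v + t • u' ∈ K := fun t ht => by
        rw [← hright t ht]; exact hσ.1 ⟨by linarith [ht.1], by linarith [ht.2]⟩
      refine ⟨min r r', lt_min hr hr', fun δ hδ hδr => ?_⟩
      have hδ1 : δ < r := hδr.trans_le (min_le_left _ _)
      have hδ2 : δ < r' := hδr.trans_le (min_le_right _ _)
      -- Carried over the bend to time s₀ - δ, this bound falls short of the remaining length D - s₀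
      -- + δ by 2δ; `guards_of_forall_lt` makes up for it below.
      have hg : Guards K T (v + δ • u') u' (D - s₀ - δ) := by
        have := hs₀P (s₀ + δ) ⟨by linarith, by linarith⟩ (min δ (r' - δ))
          (lt_min hδ (by linarith)) u' hu' (fun t ht => by
            have h1 := min_le_left δ (r' - δ)
            have h2 := min_le_right δ (r' - δ)
            rw [hright δ ⟨hδ.le, hδ2.le⟩, add_assoc,
              hright (δ + t) ⟨by linarith [ht.1], by linarith [ht.2]⟩]
            module)
        rw [hright δ ⟨hδ.le, hδ2.le⟩] at this
        exact this.mono (by linarith)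
      by_cases hvis : segment ℝ (v + δ • w) (v + δ • u') ⊆ K
      -- If the arms see each other, the segment between their ends has the length 2δ of the
      -- geodesic piece, so there is no bend at all.
      · have h1 := hK.geodesicDist_eq_dist hvis
        rw [← hleft δ ⟨hδ.le, hδ1.le⟩, ← hright δ ⟨hδ.le, hδ2.le⟩,
          hσ.2 _ ⟨by linarith, by linarith⟩ _ ⟨by linarith, by linarith⟩ (by linarith),
          hleft δ ⟨hδ.le, hδ1.le⟩, hright δ ⟨hδ.le, hδ2.le⟩, dist_eq_norm,
          show σ s₀ + δ • w - (σ s₀ + δ • u') = δ • (w - u') by module, norm_smul,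
          Real.norm_eq_abs, abs_of_pos hδ] at h1
        have h2 : ‖w - u'‖ = 2 := mul_left_cancel₀ hδ.ne' (by linarith)
        have h3 : w = -u' := by
          refine (eq_neg_or_inner_gt hw hu').resolve_right fun h => ?_
          have h4 := norm_sub_sq_real w u'
          rw [h2, hw, hu'] at h4
          linarith
        have hu'w : u' = -w := by rw [h3, neg_neg]
        subst hu'w
        refine (hK.guards_straight hT hu' (t := 2 * δ) (ρ := D - s₀ - δ) (by linarith)
          (fun s hs => ?_) ?_).mono (by linarith)
        · rcases le_total s δ with h | h
          · convert hwK (δ - s) ⟨by linarith, by linarith [hs.1]⟩ using 1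
            module
          · convert hu'K (s - δ) ⟨by linarith, by linarith [hs.2]⟩ using 1
            module
        · convert hg using 1
          module
      · exact hK.guards_turn hT hw hu' hδ (fun t ht => hwK t ⟨ht.1, ht.2.trans hδ1.le⟩)
          (fun t ht => hu'K t ⟨ht.1, ht.2.trans hδ2.le⟩) hvis hg
  obtain ⟨η, hη, key⟩ := key
  have hbefore : ∀ τ ∈ Ioo (s₀ - r) s₀, P τ := by
    intro τ hτ ε hε u hu hstr
    obtain ⟨d, hd, hdτ⟩ : ∃ d, d = s₀ - τ ∧ 0 < d := ⟨_, rfl, by linarith [hτ.2]⟩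
    have hdr : d < r := by linarith [hτ.1]
    have hz : σ τ = v + d • w := by
      rw [← hleft d ⟨hdτ.le, hdr.le⟩, hd, sub_sub_cancel]
    have hum : u = -w := by
      set t := min ε d with ht
      have ht0 : 0 < t := lt_min hε hdτ
      have h1 := hstr t ⟨by linarith, min_le_left _ _⟩
      have htd : t ≤ d := min_le_right _ _
      rw [show τ + t = s₀ - (d - t) by rw [hd]; ring,
        hleft (d - t) ⟨by linarith, by linarith⟩, hz] at h1
      have h2 : t • u = t • -w := by
        have : t • u = (v + d • w + t • u) - (v + d • w) := by abel
        rw [this, ← h1]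
        module
      exact smul_right_injective _ ht0.ne' h2
    rw [hum, hz]
    refine guards_of_forall_lt (lt_min hη hdτ) fun δ hδ hδm => ?_
    have hδη := hδm.trans_le (min_le_left _ _)
    have hδd := hδm.trans_le (min_le_right _ _)
    refine (hK.guards_straight hT (u := -w) (t := d - δ) (ρ := D - s₀ - δ) (by rwa [norm_neg])
      (by linarith) (fun s hs => ?_) ?_).mono (by linarith)
    · convert hwK (d - s) ⟨by linarith [hs.2], by linarith [hs.1]⟩ using 1
      module
    · convert key δ hδ hδη using 1
      module
  -- At `s₀` itself a guard is claimed only if σ is straight there, so it is a limit of straight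
  -- moves.
  have hat : s₀ < D → P s₀ := by
    intro hlt ε hε u hu hstr
    set δ := min ε ((D - s₀) / 2) with hδ
    have hδ0 : 0 < δ := lt_min hε (by linarith)
    have hδε : δ ≤ ε := min_le_left _ _
    have hδD : δ ≤ (D - s₀) / 2 := min_le_right _ _
    refine guards_of_forall_lt hδ0 fun e he heδ => ?_
    have h1 := hs₀P (s₀ + e) ⟨by linarith, by linarith⟩ (min e (δ - e))
      (lt_min he (by linarith)) u hu (fun t ht => by
        have h1 := min_le_left e (δ - e)
        have h2 := min_le_right e (δ - e)
        rw [hstr e ⟨by linarith, by linarith⟩, add_assoc,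
          hstr (e + t) ⟨by linarith [ht.1], by linarith [ht.2]⟩]
        module)
    rw [hstr e ⟨by linarith, by linarith⟩] at h1
    refine (hK.guards_straight hT hu he (fun s hs => ?_) h1).mono (by linarith)
    rw [← hstr s ⟨by linarith [hs.1], by linarith [hs.2]⟩]
    exact hσ.1 ⟨by linarith [hs.1], by linarith [hs.2]⟩
  have hmem : s₀ - r ∈ G := by
    refine ⟨⟨by linarith, by linarith⟩, fun τ hτ => ?_⟩
    rcases lt_trichotomy τ s₀ with h | h | h
    · exact hbefore τ ⟨hτ.1, h⟩
    · exact h ▸ hat (h ▸ hτ.2)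
    · exact hs₀P τ ⟨h, hτ.2⟩
  linarith [csInf_le hbdd hmem]

end IsFull

/-- A continuous function with a local affine support from below at each interior point is
convex. -/
theorem convexOn_of_local_support {g : ℝ → ℝ} {ℓ : ℝ} (hc : ContinuousOn g (Icc 0 ℓ))
    (h : ∀ t ∈ Ioo 0 ℓ, ∃ c, ∀ᶠ s in 𝓝 t, g t + c * (s - t) ≤ g s) :
    ConvexOn ℝ (Icc 0 ℓ) g := by
  refine LinearOrder.convexOn_of_lt (convex_Icc 0 ℓ) fun x hx y hy hxy a b ha hb hab => ?_
  set m := (g y - g x) / (y - x) with hm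
  have hm' : m * (y - x) = g y - g x := div_mul_cancel₀ _ (by linarith)
  set k : ℝ → ℝ := fun t => g t - g x - m * (t - x) with hk
  have hsub : Icc x y ⊆ Icc 0 ℓ := Icc_subset_Icc hx.1 hy.2
  have hkc : ContinuousOn k (Icc x y) :=
    ((hc.mono hsub).sub continuousOn_const).sub (by fun_prop)
  have hneg : ∀ t ∈ Icc x y, k t ≤ 0 := by
    by_contra! hcon
    obtain ⟨t₀, ht₀, hkt₀⟩ := hcon
    obtain ⟨q, hq, hqmax⟩ := isCompact_Icc.exists_isMaxOn ⟨t₀, ht₀⟩ hkc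
    have hM : 0 < k q := hkt₀.trans_le (hqmax ht₀)
    have hcl : IsCompact (Icc x y ∩ k ⁻¹' {k q}) :=
      isCompact_Icc.of_isClosed_subset
        (hkc.preimage_isClosed_of_isClosed isClosed_Icc isClosed_singleton) inter_subset_left
    -- The leftmost maximum point of the excess over the secant: the support line there has slope at
    -- most 0, which forces further maximum points to the left.
    obtain ⟨p, ⟨hp, hpq⟩, hpmin⟩ := hcl.exists_isLeast ⟨q, hq, rfl⟩
    have hpq' : k p = k q := hpq
    have hpx : x < p := lt_of_le_of_ne hp.1 fun e => by
      rw [← hpq', ← e] at hM; simp [hk] at hM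
    have hpy : p < y := lt_of_le_of_ne hp.2 fun e => by
      rw [← hpq', e] at hM; simp only [hk] at hM; linarith
    obtain ⟨c, hcs⟩ := h p ⟨hx.1.trans_lt hpx, hpy.trans_le hy.2⟩
    obtain ⟨r, hr, hball⟩ := Metric.eventually_nhds_iff.1
      (hcs.and (Ioo_mem_nhds hpx hpy))
    have hks : ∀ s, |s - p| < r → k p + (c - m) * (s - p) ≤ k s ∧ s ∈ Ioo x y := fun s hs => by
      obtain ⟨h1, h2⟩ := hball (y := s) (by rwa [Real.dist_eq])
      exact ⟨by simp only [hk]; linarith, h2⟩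
    have hcm : c - m ≤ 0 := by
      obtain ⟨h1, h2⟩ := hks (p + r / 2) (by rw [add_sub_cancel_left, abs_of_pos (by linarith)]; linarith)
      have h3 : k (p + r / 2) ≤ k q := hqmax ⟨h2.1.le, h2.2.le⟩
      rw [add_sub_cancel_left] at h1
      by_contra! hlt
      nlinarith [mul_pos hlt hr]
    obtain ⟨h1, h2⟩ := hks (p - r / 2) (by
      rw [show p - r / 2 - p = -(r / 2) by ring, abs_neg, abs_of_pos (by linarith)]; linarith)
    have h3 : k (p - r / 2) ≤ k q := hqmax ⟨h2.1.le, h2.2.le⟩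
    have h4 : p ≤ p - r / 2 := hpmin ⟨⟨h2.1.le, h2.2.le⟩, le_antisymm h3 (by nlinarith)⟩
    linarith
  have hz : a • x + b • y ∈ Icc x y := by
    simp only [smul_eq_mul]
    obtain rfl : a = 1 - b := by linarith
    constructor <;> nlinarith
  have := hneg _ hz
  simp only [hk, smul_eq_mul] at this ⊢
  obtain rfl : a = 1 - b := by linarith
  have e : m * ((1 - b) * x + b * y - x) = b * (g y - g x) := by rw [← hm']; ring
  rw [e] at this
  linarith

/-- The pieces of a shortest path are at least as long as the distances of their ends, but their sum
is at most d(a, b), so the triangle inequality is an equality along γ. The path may pause; points at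
equal distance from a coincide, so it can be parametrized by that distance. -/
theorem IsFull.exists_isUnitGeodesic_of_isShortestPath {K : Set Plane} (hK : IsFull K)
    {a b : Plane} {γ : ℝ → Plane} (hγ : IsShortestPath K a b γ) :
    ∃ σ, IsUnitGeodesic K σ (geodesicDist K a b) ∧ ∀ x ∈ γ '' Icc 0 1,
      geodesicDist K a x ∈ Icc 0 (geodesicDist K a b) ∧ σ (geodesicDist K a x) = x := by
  obtain ⟨⟨hc, hm, h0, h1⟩, hmin⟩ := hγ
  have haK : a ∈ K := h0 ▸ hm (left_mem_Icc.2 zero_le_one)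
  have hbK : b ∈ K := h1 ▸ hm (right_mem_Icc.2 zero_le_one)
  set φ : ℝ → ℝ := fun t => geodesicDist K a (γ t) with hφ
  have hlen : pathLength γ ≤ geodesicEDist K a b := le_iInf₂ hmin
  have hsum : ∀ s ∈ Icc (0 : ℝ) 1, ∀ t ∈ Icc (0 : ℝ) 1, s ≤ t →
      geodesicDist K (γ s) (γ t) = φ t - φ s ∧ φ t ≤ geodesicDist K a b := by
    intro s hs t ht hst
    have hsK := hm hs
    have htK := hm ht
    have e1 : geodesicEDist K a (γ s) + geodesicEDist K (γ s) (γ t) + geodesicEDist K (γ t) b ≤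
        geodesicEDist K a b := by
      refine le_trans ?_ hlen
      unfold pathLength
      rw [← eVariationOn_Icc_add_Icc γ (ht.1) ht.2, ← eVariationOn_Icc_add_Icc γ hs.1 hst]
      have s1 : Icc 0 s ⊆ Icc (0 : ℝ) 1 := Icc_subset_Icc_right hs.2
      have s2 : Icc s t ⊆ Icc (0 : ℝ) 1 := Icc_subset_Icc hs.1 ht.2
      have s3 : Icc t 1 ⊆ Icc (0 : ℝ) 1 := Icc_subset_Icc_left ht.1
      have i1 := geodesicEDist_le_eVariationOn hs.1 (hc.mono s1) (hm.mono_left s1)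
      have i3 := geodesicEDist_le_eVariationOn ht.2 (hc.mono s3) (hm.mono_left s3)
      rw [h0] at i1
      rw [h1] at i3
      exact add_le_add (add_le_add i1
        (geodesicEDist_le_eVariationOn hst (hc.mono s2) (hm.mono_left s2))) i3
    have e2 := ENNReal.toReal_mono (hK.finite a haK b hbK) e1
    have f1 := hK.finite a haK _ hsK
    have f2 := hK.finite _ hsK _ htK
    have f3 := hK.finite _ htK b hbK
    rw [ENNReal.toReal_add (ENNReal.add_ne_top.2 ⟨f1, f2⟩) f3, ENNReal.toReal_add f1 f2] at e2
    simp only [toReal_geodesicEDist] at e2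
    have t1 := hK.triangle haK hsK htK
    have t2 := hK.triangle haK htK hbK
    change φ s + _ + _ ≤ _ at e2
    change φ t ≤ φ s + _ at t1
    change _ ≤ φ t + _ at t2
    have := geodesicDist_nonneg K (γ t) b
    constructor <;> linarith
  have habs : ∀ s ∈ Icc (0 : ℝ) 1, ∀ t ∈ Icc (0 : ℝ) 1,
      geodesicDist K (γ s) (γ t) = |φ t - φ s| := by
    intro s hs t ht
    rcases le_total s t with h | h
    · rw [← (hsum s hs t ht h).1, abs_of_nonneg (geodesicDist_nonneg _ _ _)]
    · rw [abs_sub_comm, ← (hsum t ht s hs h).1, abs_of_nonneg (geodesicDist_nonneg _ _ _),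
        geodesicDist_comm]
  have hφc : ContinuousOn φ (Icc 0 1) := (hK.continuousOn_geodesicDist haK).comp hc hm
  have hsurj : ∀ d ∈ Icc 0 (geodesicDist K a b), ∃ t ∈ Icc (0 : ℝ) 1, φ t = d := by
    intro d hd
    have e0 : φ 0 = 0 := by simp only [hφ, h0]; exact hK.geodesicDist_self haK
    have e1 : φ 1 = geodesicDist K a b := by simp only [hφ, h1]
    exact intermediate_value_Icc zero_le_one hφc (by rwa [e0, e1])
  choose! τ hτ hφτ using hsurj
  refine ⟨fun d => γ (τ d), ⟨fun d hd => hm (hτ d hd), fun d hd e he hde => ?_⟩, ?_⟩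
  · rw [habs _ (hτ d hd) _ (hτ e he), hφτ d hd, hφτ e he, abs_of_nonneg (by linarith)]
  · rintro _ ⟨t, ht, rfl⟩
    have hmem : φ t ∈ Icc 0 (geodesicDist K a b) :=
      ⟨geodesicDist_nonneg _ _ _, (hsum t ht t ht le_rfl).2⟩
    refine ⟨hmem, ?_⟩
    have h2 := habs _ (hτ _ hmem) t ht
    rw [hφτ _ hmem, sub_self, abs_zero] at h2
    have h3 := hK.dist_le (hm (hτ _ hmem)) (hm ht)
    rw [h2] at h3
    exact dist_le_zero.1 h3

end

/-! ### Convexity of the distance to a cut-off part -/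

section

open Filter Topology

/-- `H` is a part of `K` that can only be entered through the compact convex set `T`. -/
structure IsCutOff (K T H : Set Plane) : Prop where
  subset : H ⊆ K
  base_subset : T ⊆ H
  convex : Convex ℝ T
  isCompact : IsCompact T
  nonempty : T.Nonempty
  enter : ∀ S ⊆ K, IsPreconnected S → ∀ x ∈ S, x ∉ H → ∀ y ∈ S, y ∈ H → (S ∩ T).Nonempty

theorem geodesicInfDist_le {K H : Set Plane} (x : Plane) {y : Plane} (hy : y ∈ H) :
    geodesicInfDist K x H ≤ geodesicDist K x y :=
  csInf_le ⟨0, by rintro _ ⟨z, -, rfl⟩; exact geodesicDist_nonneg _ _ _⟩ (mem_image_of_mem _ hy)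

theorem le_geodesicInfDist {K H : Set Plane} {x : Plane} {ρ : ℝ} (hne : H.Nonempty)
    (h : ∀ y ∈ H, ρ ≤ geodesicDist K x y) : ρ ≤ geodesicInfDist K x H :=
  le_csInf (hne.image _) (by rintro _ ⟨y, hy, rfl⟩; exact h y hy)

theorem geodesicInfDist_nonneg (K H : Set Plane) (x : Plane) : 0 ≤ geodesicInfDist K x H :=
  Real.sInf_nonneg (by rintro _ ⟨y, -, rfl⟩; exact geodesicDist_nonneg _ _ _)

namespace IsFull

variable {K T H : Set Plane} (hK : IsFull K)
include hK

theorem geodesicInfDist_le_add (hH : IsCutOff K T H) {x y : Plane} (hx : x ∈ K) (hy : y ∈ K) :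
    geodesicInfDist K x H ≤ geodesicDist K x y + geodesicInfDist K y H := by
  rw [← sub_le_iff_le_add']
  refine le_geodesicInfDist (hH.nonempty.mono hH.base_subset) fun z hz => ?_
  have := hK.triangle hx hy (hH.subset hz)
  linarith [geodesicInfDist_le (K := K) x hz]

theorem geodesicInfDist_eq_zero (hH : IsCutOff K T H) {x : Plane} (hx : x ∈ H) :
    geodesicInfDist K x H = 0 :=
  le_antisymm ((geodesicInfDist_le x hx).trans_eq (hK.geodesicDist_self (hH.subset hx)))
    (geodesicInfDist_nonneg _ _ _)

/-- A path into H meets T first or on the way, so bounds for the convex set T carry over to H, which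
need not be convex. -/
theorem le_geodesicInfDist_of_base (hH : IsCutOff K T H) {x : Plane} (hx : x ∈ K) (hxH : x ∉ H)
    {ρ : ℝ} (h : ∀ y ∈ T, ρ ≤ geodesicDist K x y) : ρ ≤ geodesicInfDist K x H := by
  refine le_geodesicInfDist (hH.nonempty.mono hH.base_subset) fun y hy => ?_
  refine hK.le_geodesicDist hx (hH.subset hy) fun S hSK hS hxS hyS => ?_
  obtain ⟨q, hqS, hqT⟩ := hH.enter S hSK hS x hxS hxH y hyS hy
  exact ⟨q, hqS, by linarith [h q hqT, geodesicDist_nonneg K q y]⟩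

theorem continuousOn_geodesicInfDist_comp (hH : IsCutOff K T H) {γ : ℝ → Plane} {ℓ : ℝ}
    (hγ : IsUnitGeodesic K γ ℓ) : ContinuousOn (fun t => geodesicInfDist K (γ t) H) (Icc 0 ℓ) := by
  have key : ∀ s ∈ Icc 0 ℓ, ∀ t ∈ Icc 0 ℓ,
      geodesicInfDist K (γ s) H - geodesicInfDist K (γ t) H ≤ |s - t| := by
    intro s hs t ht
    have h := hK.geodesicInfDist_le_add hH (hγ.1 hs) (hγ.1 ht)
    rcases le_total s t with hst | hst
    · rw [hγ.2 s hs t ht hst] at h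
      rw [abs_sub_comm, abs_of_nonneg (by linarith)]; linarith
    · rw [geodesicDist_comm, hγ.2 t ht s hs hst] at h
      rw [abs_of_nonneg (by linarith)]; linarith
  rw [Metric.continuousOn_iff]
  intro s hs ε hε
  refine ⟨ε, hε, fun t ht hts => ?_⟩
  rw [Real.dist_eq] at hts ⊢
  rw [abs_lt]
  have h1 := key s hs t ht
  have h2 := key t ht s hs
  rw [abs_sub_comm] at h1
  constructor <;> linarith

/-- If two directions at a point can be joined inside `K` at some scale, they can be joined at all
smaller scales of the second direction, unless they are opposite. -/
theorem segment_subset_of_visible {v w u : Plane} (hw : ‖w‖ = 1) (hu : ‖u‖ = 1) {δ : ℝ}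
    (hδ : 0 < δ) (hwK : ∀ t ∈ Icc 0 δ, v + t • w ∈ K) (huK : ∀ t ∈ Icc 0 δ, v + t • u ∈ K)
    (hvis : segment ℝ (v + δ • w) (v + δ • u) ⊆ K) (hne : u ≠ -w) {μ : ℝ} (hμ0 : 0 ≤ μ)
    (hμ : μ ≤ δ) : segment ℝ (v + δ • w) (v + μ • u) ⊆ K := by
  by_cases hcr : cross w u = 0
  · have hcs := inner_sq_add_cross_sq hw hu
    rw [hcr] at hcs
    have hgt : -1 < inner ℝ w u :=
      (eq_neg_or_inner_gt hw hu).resolve_left fun h => hne (by rw [h, neg_neg])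
    have hc1 : inner ℝ w u = (1 : ℝ) := by
      have : (inner ℝ w u - 1) * (inner ℝ w u + 1) = (0 : ℝ) := by linarith
      rcases mul_eq_zero.1 this with h' | h' <;> linarith
    obtain rfl : w = u := (inner_eq_one_iff_of_norm_eq_one hw hu).1 hc1
    rw [segment_symm, segment_subset_iff_of_le hμ]
    exact fun t ht => hwK t ⟨hμ0.trans ht.1, ht.2⟩
  · have hcr' : cross (δ • w) (δ • u) ≠ 0 := by
      have : cross (δ • w) (δ • u) = δ ^ 2 * cross w u := by simp [cross]; ring
      rw [this]; positivity
    have h1 : segment ℝ v (v + δ • w) ⊆ K := (segment_ray_subset_iff hδ.le).2 hwK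
    have h2 : segment ℝ v (v + δ • u) ⊆ K := (segment_ray_subset_iff hδ.le).2 huK
    rintro _ ⟨s, t, hs, ht, hst, rfl⟩
    have hμδ : μ / δ ≤ 1 := (div_le_one hδ).2 hμ
    have hμδ0 : 0 ≤ μ / δ := div_nonneg hμ0 hδ.le
    convert hK.mem_of_triangle hcr' h1 h2 hvis hs (mul_nonneg ht hμδ0)
      (by nlinarith) using 1
    obtain rfl : s = 1 - t := by linarith
    rw [smul_smul, smul_smul (t * (μ / δ)), show t * (μ / δ) * δ = t * μ by field_simp]
    module

/-- A geodesic has angle at least `π` at each of its points: two directions along it and a third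
one satisfy the inequality for the sum of cosines, if the third sees both. -/
theorem inner_add_inner_nonpos {v w₁ w₂ u : Plane} (hw₁ : ‖w₁‖ = 1) (hw₂ : ‖w₂‖ = 1)
    (hu : ‖u‖ = 1) {δ₁ δ₂ : ℝ} (hδ₁ : 0 < δ₁) (hδ₂ : 0 < δ₂)
    (hgeo : geodesicDist K (v + δ₁ • w₁) (v + δ₂ • w₂) = δ₁ + δ₂)
    (h₁ : ∀ μ, 0 ≤ μ → μ ≤ δ₁ → segment ℝ (v + δ₁ • w₁) (v + μ • u) ⊆ K)
    (h₂ : ∀ μ, 0 ≤ μ → μ ≤ δ₂ → segment ℝ (v + δ₂ • w₂) (v + μ • u) ⊆ K) :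
    inner ℝ w₁ u + inner ℝ w₂ u ≤ (0 : ℝ) := by
  -- The first-order expansion of the distance with an explicit error, from 2δX ≤ X² + δ² for the
  -- length X.
  have bound : ∀ (w : Plane) (δ μ : ℝ), ‖w‖ = 1 → 0 < δ → dist (v + δ • w) (v + μ • u) ≤
      δ - μ * inner ℝ w u + μ ^ 2 / (2 * δ) := by
    intro w δ μ hw hδ
    rw [dist_add_left, dist_eq_norm]
    have e : ‖δ • w - μ • u‖ ^ 2 = δ ^ 2 - 2 * (δ * μ * inner ℝ w u) + μ ^ 2 := by
      rw [norm_sub_sq_real, norm_smul, norm_smul, hw, hu, inner_smul_left, inner_smul_right,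
        mul_one, mul_one, Real.norm_eq_abs, Real.norm_eq_abs, sq_abs, sq_abs]
      simp only [conj_trivial]
      ring
    have h2 : ‖δ • w - μ • u‖ * (2 * δ) ≤ ‖δ • w - μ • u‖ ^ 2 + δ ^ 2 := by
      nlinarith [sq_nonneg (‖δ • w - μ • u‖ - δ)]
    rw [e] at h2
    have h3 : (δ - μ * inner ℝ w u + μ ^ 2 / (2 * δ)) * (2 * δ) =
        δ ^ 2 - 2 * (δ * μ * inner ℝ w u) + μ ^ 2 + δ ^ 2 := by field_simp; ring
    exact le_of_mul_le_mul_right (h2.trans_eq h3.symm) (by positivity)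
  by_contra! hpos
  set m : ℝ := inner ℝ w₁ u + inner ℝ w₂ u with hm
  set k : ℝ := 1 / (2 * δ₁) + 1 / (2 * δ₂) with hk
  have hk0 : 0 < k := by positivity
  -- Going through v + μ u changes the length by at most -μ m + μ² k, which is negative for 0 < μ ≤
  -- m / (2k).
  set μ := min (min δ₁ δ₂) (m / (2 * k)) with hμ
  have hμ0 : 0 < μ := lt_min (lt_min hδ₁ hδ₂) (by positivity)
  have hμ1 : μ ≤ δ₁ := (min_le_left _ _).trans (min_le_left _ _)
  have hμ2 : μ ≤ δ₂ := (min_le_left _ _).trans (min_le_right _ _)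
  have hμ3 : μ * (2 * k) ≤ m := (le_div_iff₀ (by positivity)).1 (min_le_right _ _)
  have s1 := h₁ μ hμ0.le hμ1
  have s2 := h₂ μ hμ0.le hμ2
  have tri := hK.triangle (s1 (left_mem_segment _ _ _)) (s1 (right_mem_segment _ _ _))
    (s2 (left_mem_segment _ _ _))
  rw [hgeo, hK.geodesicDist_eq_dist s1, geodesicDist_comm, hK.geodesicDist_eq_dist s2] at tri
  have b1 := bound w₁ δ₁ μ hw₁ hδ₁
  have b2 := bound w₂ δ₂ μ hw₂ hδ₂
  have e : μ ^ 2 / (2 * δ₁) + μ ^ 2 / (2 * δ₂) = μ ^ 2 * k := by rw [hk]; ring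
  have h3 : μ * m ≤ μ ^ 2 * k := by rw [← e, hm]; linarith
  nlinarith [mul_pos (mul_pos hμ0 hμ0) hk0]

/-- A one-sided first variation formula. The direction u towards H gives the slope -⟨w, u⟩ in a
direction w that can be joined to u, and slope 1 in one that cannot; the angle of γ at v makes the
bounds on the two sides compatible. -/
theorem exists_local_support (hH : IsCutOff K T H) {γ : ℝ → Plane} {ℓ : ℝ}
    (hγ : IsUnitGeodesic K γ ℓ) {t : ℝ} (ht : t ∈ Ioo 0 ℓ) :
    ∃ c, ∀ᶠ s in 𝓝 t, geodesicInfDist K (γ t) H + c * (s - t) ≤ geodesicInfDist K (γ s) H := by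
  have hTK : T ⊆ K := hH.base_subset.trans hH.subset
  set v := γ t with hv
  have hvK : v ∈ K := hγ.1 ⟨ht.1.le, ht.2.le⟩
  by_cases hvH : v ∈ H
  · exact ⟨0, Eventually.of_forall fun s => by
      rw [hK.geodesicInfDist_eq_zero hH hvH]; simpa using geodesicInfDist_nonneg K H (γ s)⟩
  set D := geodesicInfDist K v H with hD
  obtain ⟨y₀, hy₀, hy₀min⟩ := hH.isCompact.exists_isMinOn hH.nonempty
    ((hK.continuousOn_geodesicDist hvK).mono hTK)
  have hDy₀ : geodesicDist K v y₀ = D :=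
    le_antisymm (hK.le_geodesicInfDist_of_base hH hvK hvH fun y hy => hy₀min hy)
      (geodesicInfDist_le v (hH.base_subset hy₀))
  have hD0 : 0 < D := by
    rw [← hDy₀]
    refine lt_of_lt_of_le (dist_pos.2 fun e => hvH ?_) (hK.dist_le hvK (hTK hy₀))
    rw [e]; exact hH.base_subset hy₀
  obtain ⟨σ, hσ, hσ0, hσD⟩ := hK.exists_isUnitGeodesic hvK (hTK hy₀)
  rw [hDy₀] at hσ hσD
  have hmin : ∀ τ ∈ Icc 0 D, ∀ y ∈ T, D - τ ≤ geodesicDist K (σ τ) y := by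
    intro τ hτ y hy
    have h1 := hK.triangle hvK (hσ.1 hτ) (hTK hy)
    have h2 := hσ.2 0 ⟨le_rfl, hD0.le⟩ τ hτ hτ.1
    rw [hσ0] at h2
    have h3 : geodesicDist K v y₀ ≤ geodesicDist K v y := hy₀min hy
    linarith
  obtain ⟨r, hr, u, hu, hrD, hright⟩ := hK.exists_straight_right hσ le_rfl hD0
  simp only [zero_add, hσ0] at hright hrD
  have huK : ∀ s ∈ Icc 0 r, v + s • u ∈ K := fun s hs => by
    rw [← hright s hs]; exact hσ.1 ⟨hs.1, hs.2.trans hrD⟩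
  have guard : ∀ δ, 0 < δ → δ < r → Guards K T (v + δ • u) u (D - δ) := by
    intro δ hδ hδr
    rw [← hright δ ⟨hδ.le, hδr.le⟩]
    refine hK.guards_of_isUnitGeodesic hTK hH.convex hσ (hσD ▸ hy₀) hmin hδ (by linarith)
      (ε := min δ (r - δ)) (lt_min hδ (by linarith)) hu fun s hs => ?_
    have h1 := min_le_left δ (r - δ)
    have h2 := min_le_right δ (r - δ)
    rw [hright δ ⟨hδ.le, hδr.le⟩, hright (δ + s) ⟨by linarith [hs.1], by linarith [hs.2]⟩]
    module
  have huu : inner ℝ u u = (1 : ℝ) := by rw [real_inner_self_eq_norm_sq, hu, one_pow]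
  obtain ⟨r₀, hr₀, hstar⟩ := hK.star v hvK
  -- The first-order lower bound near `v`.
  have lower : ∀ x ∈ K, x ∉ H → dist v x < min r₀ (r / 2) →
      D - inner ℝ (x - v) u ≤ geodesicInfDist K x H := by
    intro x hxK hxH hx
    refine hK.le_geodesicInfDist_of_base hH hxK hxH fun y hy => ?_
    have hδ : (0 : ℝ) < r / 2 := by linarith
    have hseg := hstar x hxK (hx.trans_le (min_le_left _ _))
    have hb : Behind K (v + (r / 2) • u) u x := by
      refine ⟨r / 2, hδ, fun s hs => ?_, segment ℝ v x, hseg, (convex_segment _ _).isPreconnected,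
        disjoint_left.2 fun q hq hqc => ?_, ?_, right_mem_segment _ _ _⟩
      · rw [add_assoc, ← add_smul]
        exact huK _ ⟨by linarith [hs.1], by linarith [hs.2]⟩
      · have h1 := hqc.1
        rw [← sub_sub, inner_sub_left, inner_smul_left, huu] at h1
        have h2 := inner_le_dist hu v q
        have h3 : dist v q ≤ dist v x := by
          rw [segment_eq_image'] at hq
          obtain ⟨θ, hθ, rfl⟩ := hq
          rw [dist_comm, dist_eq_norm, add_sub_cancel_left, norm_smul, Real.norm_eq_abs,
            abs_of_nonneg hθ.1, ← dist_eq_norm, dist_comm x]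
          nlinarith [hθ.2, dist_nonneg (x := v) (y := x)]
        have h4 := hx.trans_le (min_le_right _ _)
        simp only [conj_trivial, mul_one] at h1
        linarith
      · convert left_mem_segment ℝ v x using 1
        module
    -- The chord at r/2 is r/2 - ⟨x - v, u⟩ away from x and D - r/2 away from T.
    have := hK.add_le_geodesicDist hTK (guard (r / 2) hδ (by linarith)) hxK hb hy
      (m := r / 2 - inner ℝ (x - v) u) fun q hq => by
        refine le_trans (le_of_eq ?_) (inner_le_dist hu x q)
        have h1 := hq.1
        rw [← sub_sub, inner_sub_left, inner_smul_left, huu] at h1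
        simp only [conj_trivial, mul_one] at h1
        rw [show q - x = (q - v) - (x - v) by abel, inner_sub_left (q - v)]
        linarith
    linarith
  -- The lower bound in directions that cannot see `u`.
  have hidden : ∀ (w : Plane) (r' : ℝ), ‖w‖ = 1 → 0 < r' → (∀ s ∈ Icc 0 r', v + s • w ∈ K) →
      (∀ δ, 0 < δ → δ ≤ min r r' → ¬ segment ℝ (v + δ • w) (v + δ • u) ⊆ K) →
      ∀ s, 0 < s → s ≤ r' → v + s • w ∉ H → D + s ≤ geodesicInfDist K (v + s • w) H := by
    intro w r' hw hr' hwK hns s hs hsr hsH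
    have hxK := hwK s ⟨hs.le, hsr⟩
    have hg : Guards K T (v + s • w) (-w) (D + s) := by
      refine guards_of_forall_lt (lt_min hs hr) fun δ hδ hδm => ?_
      have hδs := hδm.trans_le (min_le_left _ _)
      have hδr := hδm.trans_le (min_le_right _ _)
      have h1 := hK.guards_turn hTK hw hu hδ (fun s' hs' => hwK s' ⟨hs'.1, by linarith [hs'.2]⟩)
        (fun s' hs' => huK s' ⟨hs'.1, by linarith [hs'.2]⟩)
        (hns δ hδ (le_min hδr.le (by linarith))) (guard δ hδ hδr)
      refine (hK.guards_straight hTK (u := -w) (t := s - δ) (ρ := D - δ) (by rwa [norm_neg])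
        (by linarith) (fun s' hs' => ?_) ?_).mono (by linarith)
      · convert hwK (s - s') ⟨by linarith [hs'.2], by linarith [hs'.1]⟩ using 1
        module
      · convert h1 using 1
        module
    exact hK.le_geodesicInfDist_of_base hH hxK hsH fun y hy =>
      hg.2 _ (self_mem_chord hxK _) y hy
  obtain ⟨r₁, hr₁, w₁, hw₁, hr₁t, hl⟩ := hK.exists_straight_left hγ ht.1 ht.2.le
  obtain ⟨r₂, hr₂, w₂, hw₂, hr₂t, hrt⟩ := hK.exists_straight_right hγ ht.1.le ht.2
  rw [← hv] at hl hrt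
  have hw₁K : ∀ s ∈ Icc 0 r₁, v + s • w₁ ∈ K := fun s hs => by
    rw [← hl s hs]; exact hγ.1 ⟨by linarith [hs.2], by linarith [hs.1, ht.2]⟩
  have hw₂K : ∀ s ∈ Icc 0 r₂, v + s • w₂ ∈ K := fun s hs => by
    rw [← hrt s hs]; exact hγ.1 ⟨by linarith [hs.1, ht.1], by linarith [hs.2]⟩
  have lip : ∀ s ∈ Icc 0 ℓ, D - |s - t| ≤ geodesicInfDist K (γ s) H := by
    intro s hs
    have h := hK.geodesicInfDist_le_add hH hvK (hγ.1 hs)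
    rcases le_total s t with hst | hst
    · rw [geodesicDist_comm, hγ.2 s hs t ⟨ht.1.le, ht.2.le⟩ hst] at h
      rw [abs_sub_comm, abs_of_nonneg (by linarith)]; linarith
    · rw [hγ.2 t ⟨ht.1.le, ht.2.le⟩ s hs hst] at h
      rw [abs_of_nonneg (by linarith)]; linarith
  have notin : ∀ s ∈ Icc 0 ℓ, |s - t| < D → γ s ∉ H := fun s hs hsD h => by
    have := lip s hs
    rw [hK.geodesicInfDist_eq_zero hH h] at this
    linarith
  set η := min (min r₁ r₂) (min D (min r₀ (r / 2))) with hη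
  have hη0 : 0 < η := lt_min (lt_min hr₁ hr₂) (lt_min hD0 (lt_min hr₀ (by linarith)))
  have hη1 : η ≤ r₁ := (min_le_left _ _).trans (min_le_left _ _)
  have hη2 : η ≤ r₂ := (min_le_left _ _).trans (min_le_right _ _)
  have hη3 : η ≤ D := (min_le_right _ _).trans (min_le_left _ _)
  have hη4 : η ≤ min r₀ (r / 2) := (min_le_right _ _).trans (min_le_right _ _)
  -- It suffices to bound both sides.
  suffices hs : ∃ c : ℝ, (∀ s, 0 < s → s < η → D - c * s ≤ geodesicInfDist K (v + s • w₁) H) ∧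
      ∀ s, 0 < s → s < η → D + c * s ≤ geodesicInfDist K (v + s • w₂) H by
    obtain ⟨c, hc1, hc2⟩ := hs
    refine ⟨c, ?_⟩
    filter_upwards [Ioo_mem_nhds (show t - η < t by linarith) (show t < t + η by linarith)]
      with s hs
    rcases lt_trichotomy s t with h | h | h
    · have h1 := hl (t - s) ⟨by linarith, by linarith [hs.1]⟩
      rw [sub_sub_cancel] at h1
      rw [h1]
      have := hc1 (t - s) (by linarith) (by linarith [hs.1])
      linarith
    · rw [h]; simp [hD, hv]
    · have h1 := hrt (s - t) ⟨by linarith, by linarith [hs.2]⟩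
      rw [add_sub_cancel] at h1
      rw [h1]
      exact hc2 (s - t) (by linarith) (by linarith [hs.2])
  have mem1 : ∀ s, 0 < s → s < η → v + s • w₁ ∉ H ∧
      D - s ≤ geodesicInfDist K (v + s • w₁) H := by
    intro s hs hsη
    have e : |t - s - t| = s := by rw [show t - s - t = -s by ring, abs_neg, abs_of_pos hs]
    rw [← hl s ⟨hs.le, by linarith⟩]
    have hm : t - s ∈ Icc 0 ℓ := ⟨by linarith, by linarith [ht.2]⟩
    have := lip _ hm
    rw [e] at this
    exact ⟨notin _ hm (by rw [e]; linarith), this⟩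
  have mem2 : ∀ s, 0 < s → s < η → v + s • w₂ ∉ H ∧
      D - s ≤ geodesicInfDist K (v + s • w₂) H := by
    intro s hs hsη
    have e : |t + s - t| = s := by rw [add_sub_cancel_left, abs_of_pos hs]
    rw [← hrt s ⟨hs.le, by linarith⟩]
    have hm : t + s ∈ Icc 0 ℓ := ⟨by linarith [ht.1], by linarith⟩
    have := lip _ hm
    rw [e] at this
    exact ⟨notin _ hm (by rw [e]; linarith), this⟩
  by_cases hv₁ : ∀ δ, 0 < δ → δ ≤ min r r₁ → ¬ segment ℝ (v + δ • w₁) (v + δ • u) ⊆ K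
  -- To the left the distance grows at unit rate; to the right slope -1 is the Lipschitz bound.
  · refine ⟨-1, fun s hs hsη => ?_, fun s hs hsη => ?_⟩
    · linarith [hidden w₁ r₁ hw₁ hr₁ hw₁K hv₁ s hs (by linarith) (mem1 s hs hsη).1]
    · linarith [(mem2 s hs hsη).2]
  by_cases hv₂ : ∀ δ, 0 < δ → δ ≤ min r r₂ → ¬ segment ℝ (v + δ • w₂) (v + δ • u) ⊆ K
  · refine ⟨1, fun s hs hsη => ?_, fun s hs hsη => ?_⟩
    · linarith [(mem1 s hs hsη).2]
    · linarith [hidden w₂ r₂ hw₂ hr₂ hw₂K hv₂ s hs (by linarith) (mem2 s hs hsη).1]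
  have hsum : inner ℝ w₁ u + inner ℝ w₂ u ≤ (0 : ℝ) := by
    have le1 : ∀ w : Plane, ‖w‖ = 1 → inner ℝ w u ≤ (1 : ℝ) := fun w hw => by
      simpa [hw, hu] using real_inner_le_norm w u
    -- Opposite directions are excluded from the visibility lemma, but then one cosine is -1 and the
    -- other at most 1.
    by_cases e1 : u = -w₁
    · have : inner ℝ w₁ u = (-1 : ℝ) := by
        rw [e1, inner_neg_right, real_inner_self_eq_norm_sq, hw₁, one_pow]
      linarith [le1 w₂ hw₂]
    by_cases e2 : u = -w₂
    · have : inner ℝ w₂ u = (-1 : ℝ) := by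
        rw [e2, inner_neg_right, real_inner_self_eq_norm_sq, hw₂, one_pow]
      linarith [le1 w₁ hw₁]
    push Not at hv₁ hv₂
    obtain ⟨δ₁, hδ₁, hδ₁r, hvis₁⟩ := hv₁
    obtain ⟨δ₂, hδ₂, hδ₂r, hvis₂⟩ := hv₂
    have a1 := hδ₁r.trans (min_le_left _ _)
    have a2 := hδ₁r.trans (min_le_right _ _)
    have b1 := hδ₂r.trans (min_le_left _ _)
    have b2 := hδ₂r.trans (min_le_right _ _)
    refine hK.inner_add_inner_nonpos hw₁ hw₂ hu hδ₁ hδ₂ (v := v) ?_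
      (fun μ h0 h1 => hK.segment_subset_of_visible hw₁ hu hδ₁
        (fun s hs => hw₁K s ⟨hs.1, hs.2.trans a2⟩) (fun s hs => huK s ⟨hs.1, hs.2.trans a1⟩)
        hvis₁ e1 h0 h1)
      (fun μ h0 h1 => hK.segment_subset_of_visible hw₂ hu hδ₂
        (fun s hs => hw₂K s ⟨hs.1, hs.2.trans b2⟩) (fun s hs => huK s ⟨hs.1, hs.2.trans b1⟩)
        hvis₂ e2 h0 h1)
    rw [← hl δ₁ ⟨hδ₁.le, a2⟩, ← hrt δ₂ ⟨hδ₂.le, b2⟩,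
      hγ.2 _ ⟨by linarith, by linarith [ht.2]⟩ _ ⟨by linarith [ht.1], by linarith⟩ (by linarith)]
    ring
  have bound : ∀ w : Plane, ‖w‖ = 1 → ∀ s, 0 < s → s < η → v + s • w ∈ K → v + s • w ∉ H →
      D - inner ℝ w u * s ≤ geodesicInfDist K (v + s • w) H := by
    intro w hw s hs hsη hsK hsH
    have := lower _ hsK hsH (by rw [dist_add_smul hw hs.le]; linarith)
    rw [add_sub_cancel_left, inner_smul_left, conj_trivial] at this
    linarith
  -- The exact slope on the right; on the left it suffices because ⟨w₁, u⟩ ≤ -⟨w₂, u⟩.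
  refine ⟨-inner ℝ w₂ u, fun s hs hsη => ?_, fun s hs hsη => ?_⟩
  · have := bound w₁ hw₁ s hs hsη (hw₁K s ⟨hs.le, by linarith⟩) (mem1 s hs hsη).1
    nlinarith
  · have := bound w₂ hw₂ s hs hsη (hw₂K s ⟨hs.le, by linarith⟩) (mem2 s hs hsη).1
    linarith

theorem convexOn_geodesicInfDist_comp (hH : IsCutOff K T H) {γ : ℝ → Plane} {ℓ : ℝ}
    (hγ : IsUnitGeodesic K γ ℓ) :
    ConvexOn ℝ (Icc 0 ℓ) fun t => geodesicInfDist K (γ t) H :=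
  convexOn_of_local_support (hK.continuousOn_geodesicInfDist_comp hH hγ) fun _ ht =>
    hK.exists_local_support hH hγ ht

end IsFull

end

/-! ### Polygons are full, half-polygons are cut off -/

section

open Filter Topology

theorem isPreconnected_norm_gt {R : ℝ} (hR : 0 ≤ R) : IsPreconnected {x : Plane | R < ‖x‖} := by
  have h1 : IsPreconnected (Metric.sphere (0 : Plane) 1 ×ˢ Ioi R) :=
    (isPreconnected_sphere (Module.lt_rank_of_lt_finrank (by simp)) 0 1).prod isPreconnected_Ioi
  convert h1.image (fun p : Plane × ℝ => p.2 • p.1) (by fun_prop) using 1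
  ext x
  constructor
  · intro hx
    have hx' : R < ‖x‖ := hx
    have h0 : ‖x‖ ≠ 0 := (hR.trans_lt hx').ne'
    refine ⟨(‖x‖⁻¹ • x, ‖x‖), ⟨?_, hx'⟩, ?_⟩
    · rw [mem_sphere_zero_iff_norm, norm_smul, norm_inv, norm_norm, inv_mul_cancel₀ h0]
    · simp only [smul_smul, mul_inv_cancel₀ h0, one_smul]
  · rintro ⟨⟨y, t⟩, ⟨hy, ht⟩, rfl⟩
    rw [mem_sphere_zero_iff_norm] at hy
    have ht' : R < t := ht
    change R < ‖t • y‖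
    rw [norm_smul, hy, mul_one, Real.norm_eq_abs, abs_of_nonneg (hR.trans ht'.le)]
    exact ht'

/-- Close to each point, a segment is a cone with that point as apex. -/
theorem eventually_segment_cone (a b p : Plane) :
    ∀ᶠ q in 𝓝 p, (∀ k ∈ Ioc (0 : ℝ) 1, p + k • (q - p) ∈ segment ℝ a b → q ∈ segment ℝ a b) ∧
      (q ∈ segment ℝ a b → p ∈ segment ℝ a b) := by
  have hcl : IsClosed (segment ℝ a b) := by
    rw [segment_eq_image_lineMap]
    exact (isCompact_Icc.image AffineMap.lineMap_continuous).isClosed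
  by_cases hp : p ∈ segment ℝ a b
  swap
  · obtain ⟨r, hr, hball⟩ := Metric.isOpen_iff.1 hcl.isOpen_compl p hp
    filter_upwards [Metric.ball_mem_nhds p hr] with q hq
    refine ⟨fun k hk h => absurd h (hball ?_), fun h => absurd h (hball hq)⟩
    rw [Metric.mem_ball, dist_eq_norm, add_sub_cancel_left, norm_smul, Real.norm_eq_abs,
      abs_of_pos hk.1]
    rw [Metric.mem_ball, dist_eq_norm] at hq
    nlinarith [hk.2, norm_nonneg (q - p)]
  · suffices h : ∀ᶠ q in 𝓝 p, ∀ k ∈ Ioc (0 : ℝ) 1, p + k • (q - p) ∈ segment ℝ a b →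
        q ∈ segment ℝ a b from h.mono fun q hq => ⟨hq, fun _ => hp⟩
    rcases eq_or_ne a b with rfl | hab
    · refine Eventually.of_forall fun q k hk h => ?_
      rw [segment_same, mem_singleton_iff] at hp h ⊢
      rw [hp, add_eq_left, smul_eq_zero, sub_eq_zero] at h
      exact h.resolve_left hk.1.ne'
    · rw [segment_eq_image'] at hp
      obtain ⟨μ, ⟨hμ0, hμ1⟩, hpμ⟩ := hp
      have hL : 0 < ‖b - a‖ := norm_pos_iff.2 (sub_ne_zero.2 hab.symm)
      set L := ‖b - a‖ with hLdef
      -- Only the ends of the segment other than p restrict q. If p is itself an end, the sign of `ν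
      -- - μ` keeps q on the right side of it.
      have e1 : ∀ᶠ q in 𝓝 p, 0 < μ → dist q p < μ * L := by
        rcases hμ0.eq_or_lt with h | h
        · exact Eventually.of_forall fun q hq => absurd hq (by rw [← h]; exact lt_irrefl _)
        · exact Filter.mem_of_superset (Metric.ball_mem_nhds p (mul_pos h hL)) fun q hq _ => hq
      have e2 : ∀ᶠ q in 𝓝 p, μ < 1 → dist q p < (1 - μ) * L := by
        rcases hμ1.eq_or_lt with h | h
        · exact Eventually.of_forall fun q hq => absurd hq (by rw [h]; exact lt_irrefl _)
        · exact Filter.mem_of_superset (Metric.ball_mem_nhds p (mul_pos (sub_pos.2 h) hL))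
            fun q hq _ => hq
      filter_upwards [e1, e2] with q h1 h2 k hk hy
      rw [segment_eq_image'] at hy ⊢
      obtain ⟨ν, ⟨hν0, hν1⟩, hyν⟩ := hy
      simp only at hpμ hyν
      -- The parameter of `q` on the line through `a` and `b`.
      set κ := μ + (ν - μ) / k with hκ
      have hk0 := hk.1
      have hq : q - p = (κ - μ) • (b - a) := by
        have h3 : k • (q - p) = (ν - μ) • (b - a) := by
          have : k • (q - p) = (a + ν • (b - a)) - (a + μ • (b - a)) := by rw [hyν, hpμ]; abel
          rw [this]; module
        have h4 : q - p = k⁻¹ • k • (q - p) := by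
          rw [smul_smul, inv_mul_cancel₀ hk0.ne', one_smul]
        rw [h4, h3, smul_smul, hκ]
        congr 1
        field_simp
        ring
      have hd : dist q p = |κ - μ| * L := by rw [dist_eq_norm, hq, norm_smul, Real.norm_eq_abs]
      refine ⟨κ, ⟨?_, ?_⟩, ?_⟩
      · rcases hμ0.eq_or_lt with h | h
        · rw [hκ, ← h]; simp; positivity
        · have := h1 h
          rw [hd] at this
          have := lt_of_mul_lt_mul_right this hL.le
          linarith [(abs_lt.1 this).1]
      · rcases hμ1.eq_or_lt with h | h
        · rw [hκ, h]
          have : (ν - 1) / k ≤ 0 := div_nonpos_of_nonpos_of_nonneg (by linarith) hk0.le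
          linarith
        · have := h2 h
          rw [hd] at this
          have := lt_of_mul_lt_mul_right this hL.le
          linarith [(abs_lt.1 this).2]
      · have : q = p + (κ - μ) • (b - a) := by rw [← hq]; abel
        rw [this, ← hpμ]
        simp only
        module

namespace Polygon

variable {n : ℕ}

theorem mem_boundary_iff (P : Polygon Plane n) {x : Plane} :
    x ∈ P.boundary ℝ ↔ ∃ i, x ∈ segment ℝ (P i) (P (finRotate n i)) := by
  simp [boundary, edgeSet, affineSegment_eq_segment]

theorem isCompact_boundary (P : Polygon Plane n) : IsCompact (P.boundary ℝ) := by
  refine isCompact_iUnion fun i => ?_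
  rw [edgeSet_eq_image_edgePath]
  exact isCompact_Icc.image AffineMap.lineMap_continuous

theorem boundary_subset_region (P : Polygon Plane n) : P.boundary ℝ ⊆ P.region :=
  subset_union_left

theorem mem_region_of_mem_component (P : Polygon Plane n) {x y : Plane} (hx : x ∈ P.region)
    (hy : y ∈ connectedComponentIn (P.boundary ℝ)ᶜ x) : y ∈ P.region := by
  have hxb : x ∈ (P.boundary ℝ)ᶜ := connectedComponentIn_nonempty_iff.1 ⟨y, hy⟩
  refine Or.inr ⟨connectedComponentIn_subset _ _ hy, ?_⟩
  rw [← connectedComponentIn_eq hy]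
  exact (hx.resolve_left hxb).2

theorem not_mem_region_of_mem_component (P : Polygon Plane n) {x y : Plane} (hx : x ∉ P.region)
    (hy : y ∈ connectedComponentIn (P.boundary ℝ)ᶜ x) : y ∉ P.region := fun h => by
  have hxb : x ∈ (P.boundary ℝ)ᶜ := connectedComponentIn_nonempty_iff.1 ⟨y, hy⟩
  refine hx (P.mem_region_of_mem_component h ?_)
  rw [← connectedComponentIn_eq hy]
  exact mem_connectedComponentIn hxb

/-- At a boundary point every edge is locally a cone, so the half-open segment from p to a nearby q
off the boundary avoids the boundary and stays in the component of q. -/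
theorem star_region (P : Polygon Plane n) {p : Plane} (hp : p ∈ P.region) :
    ∃ r > 0, ∀ q ∈ P.region, dist p q < r → segment ℝ p q ⊆ P.region := by
  by_cases hpb : p ∈ P.boundary ℝ
  · have h := eventually_all.2 fun i => eventually_segment_cone (P i) (P (finRotate n i)) p
    obtain ⟨r, hr, h⟩ := Metric.eventually_nhds_iff.1 h
    refine ⟨r, hr, fun q hq hpq => ?_⟩
    have hcone := h (by rwa [dist_comm] at hpq)
    by_cases hqb : q ∈ P.boundary ℝ
    · obtain ⟨i, hi⟩ := P.mem_boundary_iff.1 hqb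
      refine ((convex_segment _ _).segment_subset ((hcone i).2 hi) hi).trans fun x hx => ?_
      exact P.boundary_subset_region (P.mem_boundary_iff.2 ⟨i, hx⟩)
    · have hray : IsPreconnected ((fun k : ℝ => p + k • (q - p)) '' Ioc 0 1) :=
        isPreconnected_ray p (q - p) isPreconnected_Ioc
      have hsub : (fun k : ℝ => p + k • (q - p)) '' Ioc 0 1 ⊆ (P.boundary ℝ)ᶜ := by
        rintro _ ⟨k, hk, rfl⟩ hb
        obtain ⟨i, hi⟩ := P.mem_boundary_iff.1 hb
        exact hqb (P.mem_boundary_iff.2 ⟨i, (hcone i).1 k hk hi⟩)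
      have hcomp := hray.subset_connectedComponentIn
        (x := q) ⟨1, ⟨one_pos, le_rfl⟩, by simp⟩ hsub
      rw [segment_eq_image']
      rintro _ ⟨k, hk, rfl⟩
      rcases hk.1.eq_or_lt with h | h
      · simpa [← h] using hp
      · exact P.mem_region_of_mem_component hq (hcomp ⟨k, ⟨h, hk.2⟩, rfl⟩)
  · obtain ⟨r, hr, hball⟩ := Metric.isOpen_iff.1 P.isCompact_boundary.isClosed.isOpen_compl p hpb
    refine ⟨r, hr, fun q _ hpq => ?_⟩
    have hcomp := (convex_ball p r).isPreconnected.subset_connectedComponentIn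
      (Metric.mem_ball_self hr) hball
    refine ((convex_ball p r).segment_subset (Metric.mem_ball_self hr)
      (by rwa [Metric.mem_ball, dist_comm])).trans fun x hx => ?_
    exact P.mem_region_of_mem_component hp (hcomp hx)

theorem isClosed_region (P : Polygon Plane n) : IsClosed P.region := by
  rw [← isOpen_compl_iff, isOpen_iff_mem_nhds]
  intro x hx
  have hxb : x ∈ (P.boundary ℝ)ᶜ := fun h => hx (P.boundary_subset_region h)
  filter_upwards [(P.isCompact_boundary.isClosed.isOpen_compl.connectedComponentIn).mem_nhds
    (mem_connectedComponentIn hxb)] with y hy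
  exact P.not_mem_region_of_mem_component hx hy

theorem exists_outside (P : Polygon Plane n) :
    ∃ R, 0 ≤ R ∧ {x : Plane | R < ‖x‖} ⊆ (P.boundary ℝ)ᶜ := by
  obtain ⟨R, hR⟩ := P.isCompact_boundary.isBounded.subset_closedBall 0
  refine ⟨max R 0, le_max_right _ _, fun x hx hxb => ?_⟩
  have h1 := hR hxb
  rw [mem_closedBall_zero_iff] at h1
  exact absurd (lt_of_le_of_lt (le_max_left R 0) hx) (not_lt.2 h1)

/-- The outside of a large disc is connected and misses the boundary, so a component meeting it is
unbounded. -/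
theorem isCompact_region (P : Polygon Plane n) : IsCompact P.region := by
  refine Metric.isCompact_of_isClosed_isBounded P.isClosed_region ?_
  obtain ⟨R, hR0, hR⟩ := P.exists_outside
  refine (Metric.isBounded_closedBall (x := (0 : Plane)) (r := R)).subset fun x hx => ?_
  rw [mem_closedBall_zero_iff]
  by_contra! hlt
  have hb := (hx.resolve_left (hR hlt)).2
  have hsub := (isPreconnected_norm_gt hR0).subset_connectedComponentIn (x := x) hlt hR
  obtain ⟨R', hR'⟩ := (hb.subset hsub).subset_closedBall 0
  obtain ⟨y, hy⟩ := NormedSpace.exists_lt_norm ℝ Plane (max R R')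
  have h1 := hR' (show R < ‖y‖ from (le_max_left _ _).trans_lt hy)
  rw [mem_closedBall_zero_iff] at h1
  exact absurd ((le_max_right _ _).trans_lt hy) (not_lt.2 h1)

/-- Every unbounded component reaches the connected outside of a large disc and hence contains it.
-/
theorem isPreconnected_compl_region (P : Polygon Plane n) : IsPreconnected P.regionᶜ := by
  obtain ⟨R, hR0, hR⟩ := P.exists_outside
  obtain ⟨o, ho⟩ := NormedSpace.exists_lt_norm ℝ Plane R
  refine isPreconnected_of_forall o fun x hx => ?_
  have hxb : x ∈ (P.boundary ℝ)ᶜ := fun h => hx (P.boundary_subset_region h)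
  have hunb : ¬ Bornology.IsBounded (connectedComponentIn (P.boundary ℝ)ᶜ x) :=
    fun h => hx (Or.inr ⟨hxb, h⟩)
  have hmeet : ∃ y ∈ connectedComponentIn (P.boundary ℝ)ᶜ x, R < ‖y‖ := by
    by_contra! hcon
    exact hunb ((Metric.isBounded_closedBall (x := (0 : Plane)) (r := R)).subset fun y hy =>
      mem_closedBall_zero_iff.2 (hcon y hy))
  obtain ⟨y, hy, hyR⟩ := hmeet
  have hsub := (isPreconnected_norm_gt hR0).subset_connectedComponentIn (x := y) hyR hR
  rw [← connectedComponentIn_eq hy] at hsub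
  exact ⟨_, fun z hz => P.not_mem_region_of_mem_component hx hz, hsub ho,
    mem_connectedComponentIn hxb, isPreconnected_connectedComponentIn⟩

/-- A ray in a fixed direction must leave the bounded component of x, and it does so at a boundary
point. -/
theorem exists_segment_to_boundary (P : Polygon Plane n) {x : Plane} (hx : x ∈ P.region) :
    ∃ y ∈ P.boundary ℝ, segment ℝ x y ⊆ P.region := by
  by_cases hxb : x ∈ P.boundary ℝ
  · exact ⟨x, hxb, by simpa using hx⟩
  set C := connectedComponentIn (P.boundary ℝ)ᶜ x with hC
  have hCb : Bornology.IsBounded C := (hx.resolve_left hxb).2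
  have hCo : IsOpen C := P.isCompact_boundary.isClosed.isOpen_compl.connectedComponentIn
  have hxC : x ∈ C := mem_connectedComponentIn hxb
  obtain ⟨e, he⟩ : ∃ e : Plane, ‖e‖ = 1 := ⟨EuclideanSpace.single 0 1, by simp⟩
  set Λ : Set ℝ := Ici 0 ∩ (fun t : ℝ => x + t • e) ⁻¹' Cᶜ with hΛ
  have hΛc : IsClosed Λ := isClosed_Ici.inter (hCo.isClosed_compl.preimage (by fun_prop))
  have hΛne : Λ.Nonempty := by
    obtain ⟨R, hR⟩ := hCb.subset_closedBall x
    have hR0 : 0 ≤ R := dist_nonneg.trans (Metric.mem_closedBall.1 (hR hxC))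
    refine ⟨R + 1, by rw [mem_Ici]; linarith, fun h => ?_⟩
    have := hR h
    rw [Metric.mem_closedBall, dist_comm, dist_add_smul he (by linarith)] at this
    linarith
  have hbdd : BddBelow Λ := ⟨0, fun t ht => ht.1⟩
  set m := sInf Λ with hm
  have hmΛ : m ∈ Λ := hΛc.csInf_mem hΛne hbdd
  have hlt : ∀ t, 0 ≤ t → t < m → x + t • e ∈ C := fun t h0 htm => by
    by_contra h
    exact absurd (csInf_le hbdd (show t ∈ Λ from ⟨h0, h⟩)) (not_le.2 htm)
  have hmb : x + m • e ∈ P.boundary ℝ := by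
    by_contra hmb
    refine hmΛ.2 ((isPreconnected_ray x e (isPreconnected_Icc (a := 0) (b := m))
      ).subset_connectedComponentIn (x := x) ⟨0, ⟨le_rfl, hmΛ.1⟩, by simp⟩ ?_
      ⟨m, ⟨hmΛ.1, le_rfl⟩, rfl⟩)
    rintro _ ⟨t, ht, rfl⟩
    rcases ht.2.eq_or_lt with h | h
    · rw [h]; exact hmb
    · exact connectedComponentIn_subset _ _ (hlt t ht.1 h)
  refine ⟨_, hmb, (segment_ray_subset_iff hmΛ.1).2 fun t ht => ?_⟩
  rcases ht.2.eq_or_lt with h | h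
  · rw [h]; exact P.boundary_subset_region hmb
  · exact P.mem_region_of_mem_component hx (hlt t ht.1 h)

/-- Any point reaches an edge by a segment, and then vertex 0 along edges. -/
theorem geodesicEDist_ne_top [NeZero n] (P : Polygon Plane n) {a b : Plane} (ha : a ∈ P.region)
    (hb : b ∈ P.region) : geodesicEDist P.region a b ≠ ⊤ := by
  have hseg : ∀ {x y : Plane}, segment ℝ x y ⊆ P.region → geodesicEDist P.region x y ≠ ⊤ :=
    fun h => ne_top_of_le_ne_top (edist_ne_top _ _) (geodesicEDist_le_edist h)
  have htrans : ∀ {x y z : Plane}, geodesicEDist P.region x y ≠ ⊤ →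
      geodesicEDist P.region y z ≠ ⊤ → geodesicEDist P.region x z ≠ ⊤ := fun h1 h2 =>
    ne_top_of_le_ne_top (ENNReal.add_ne_top.2 ⟨h1, h2⟩) (geodesicEDist_triangle _ _ _ _)
  have hedge : ∀ i, segment ℝ (P i) (P (finRotate n i)) ⊆ P.region := fun i x hx =>
    P.boundary_subset_region (P.mem_boundary_iff.2 ⟨i, hx⟩)
  have hvert : ∀ i, geodesicEDist P.region (P 0) (P i) ≠ ⊤ := by
    obtain ⟨m, rfl⟩ := Nat.exists_eq_succ_of_ne_zero (NeZero.ne n)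
    intro i
    induction i using Fin.induction with
    | zero => exact hseg (by simpa using hedge 0 (left_mem_segment _ _ _))
    | succ i ih =>
      refine htrans ih (hseg ?_)
      have := hedge i.castSucc
      rwa [finRotate_apply, Fin.coeSucc_eq_succ] at this
  have hbase : ∀ x ∈ P.region, geodesicEDist P.region (P 0) x ≠ ⊤ := by
    intro x hx
    obtain ⟨y, hy, hxy⟩ := P.exists_segment_to_boundary hx
    obtain ⟨i, hi⟩ := P.mem_boundary_iff.1 hy
    refine htrans (htrans (hvert i) (hseg (y := y) ?_)) (hseg (by rwa [segment_symm]))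
    exact ((convex_segment _ _).segment_subset (left_mem_segment _ _ _) hi).trans (hedge i)
  exact htrans (by rw [geodesicEDist_comm]; exact hbase a ha) (hbase b hb)

theorem isFull_region [NeZero n] (P : Polygon Plane n) : IsFull P.region where
  isCompact := P.isCompact_region
  compl := P.isPreconnected_compl_region
  star := fun _ hp => P.star_region hp
  finite := fun _ ha _ hb => P.geodesicEDist_ne_top ha hb

/-- A connected set that avoids the chord stays in one component of the rest, and a half-polygon
contains such components wholly or not at all. -/
theorem IsHalfPolygon.exists_isCutOff [NeZero n] {P : Polygon Plane n} {H : Set Plane}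
    (hH : P.IsHalfPolygon H) : ∃ T, IsCutOff P.region T H := by
  obtain ⟨s, t, -, -, -, -, ⟨-, -, -, hseg⟩, rfl⟩ := hH
  set T := segment ℝ (P.loop s) (P.loop t) with hT
  refine ⟨T, union_subset hseg ?_, subset_union_left, convex_segment _ _, ?_,
    ⟨_, left_mem_segment _ _ _⟩, ?_⟩
  · rintro x ⟨y, hy, -⟩
    exact (connectedComponentIn_nonempty_iff.1 ⟨y, hy⟩).1
  · rw [hT, segment_eq_image_lineMap]
    exact isCompact_Icc.image AffineMap.lineMap_continuous
  · intro S hSK hS x hxS hxH y hyS hyH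
    by_contra hne
    rw [not_nonempty_iff_eq_empty, ← disjoint_iff_inter_eq_empty] at hne
    have hsub : S ⊆ P.region \ T := fun z hz => ⟨hSK hz, disjoint_left.1 hne hz⟩
    have hyT := hyH.resolve_left (disjoint_left.1 hne hyS)
    refine hxH (Or.inr ?_)
    rw [mem_ofPred_eq, ← hT, connectedComponentIn_eq (hS.subset_connectedComponentIn hxS hsub hyS)]
    exact hyT

end Polygon

theorem IsFull.geodesicallyConvexFun {K : Set Plane} (hK : IsFull K) {f : Plane → ℝ}
    (hf : ∀ γ ℓ, IsUnitGeodesic K γ ℓ → ConvexOn ℝ (Icc 0 ℓ) fun t => f (γ t)) :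
    GeodesicallyConvexFun K f := by
  intro a _ b _ γ hγ
  obtain ⟨σ, hσ, h⟩ := hK.exists_isUnitGeodesic_of_isShortestPath hγ
  exact ⟨fun t => f (σ t), hf σ _ hσ, fun x hx => congrArg f (h x hx).2.symm⟩

theorem IsFull.isGeodesicallyConvex_sublevel {K : Set Plane} (hK : IsFull K) {f : Plane → ℝ}
    (hf : GeodesicallyConvexFun K f) (t : ℝ) : IsGeodesicallyConvex K {x | x ∈ K ∧ f x ≤ t} := by
  refine ⟨fun x hx => hx.1, fun a ha b hb γ hγ => ?_⟩
  obtain ⟨g, hg, hfg⟩ := hf a ha.1 b hb.1 γ hγ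
  obtain ⟨σ, -, h⟩ := hK.exists_isUnitGeodesic_of_isShortestPath hγ
  have haγ : a ∈ γ '' Icc 0 1 := ⟨0, left_mem_Icc.2 zero_le_one, hγ.1.2.2.1⟩
  have hbγ : b ∈ γ '' Icc 0 1 := ⟨1, right_mem_Icc.2 zero_le_one, hγ.1.2.2.2⟩
  rintro _ ⟨s, hs, rfl⟩
  have hx : γ s ∈ γ '' Icc 0 1 := mem_image_of_mem _ hs
  refine ⟨hγ.1.2.1 hs, ?_⟩
  have hle := hg.le_max_of_mem_Icc (left_mem_Icc.2 (geodesicDist_nonneg K a b))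
    (right_mem_Icc.2 (geodesicDist_nonneg K a b)) (h _ hx).1
  rw [← hfg _ hx, ← hfg b hbγ] at hle
  have h0 := hfg a haγ
  rw [hK.geodesicDist_self ha.1] at h0
  rw [← h0] at hle
  exact hle.trans (max_le ha.2 hb.2)

end

theorem corollary1 {n : ℕ} [NeZero n] (P : Polygon Plane n) (hP : P.IsSimple)
    (ℋ : Finset (Set Plane)) (hne : ℋ.Nonempty) (hℋ : ∀ H ∈ ℋ, P.IsHalfPolygon H) :
    GeodesicallyConvexFun P.region (geodesicRadius P.region ℋ hne) ∧
    (∀ H : Set Plane, P.IsHalfPolygon H → ∀ t : ℝ,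
      IsGeodesicallyConvex P.region {x | x ∈ P.region ∧ geodesicInfDist P.region x H ≤ t}) ∧
    (∀ t : ℝ,
      IsGeodesicallyConvex P.region {x | x ∈ P.region ∧ geodesicRadius P.region ℋ hne x ≤ t}) := by
  have hK := P.isFull_region
  have hconv : ∀ H, P.IsHalfPolygon H → ∀ γ ℓ, IsUnitGeodesic P.region γ ℓ →
      ConvexOn ℝ (Icc 0 ℓ) fun t => geodesicInfDist P.region (γ t) H := fun H hH γ ℓ hγ => by
    obtain ⟨T, hT⟩ := hH.exists_isCutOff
    exact hK.convexOn_geodesicInfDist_comp hT hγ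
  have hrad : GeodesicallyConvexFun P.region (geodesicRadius P.region ℋ hne) := by
    -- A maximum of convex functions is convex: the inequality is checked for each H and its right
    -- side enlarged.
    refine hK.geodesicallyConvexFun fun γ ℓ hγ => ⟨convex_Icc 0 ℓ, fun x hx y hy a b ha hb hab => ?_⟩
    refine Finset.sup'_le hne _ fun H hH => ?_
    refine ((hconv H (hℋ H hH) γ ℓ hγ).2 hx hy ha hb hab).trans ?_
    have hle : ∀ z, geodesicInfDist P.region z H ≤ geodesicRadius P.region ℋ hne z := fun z =>
      Finset.le_sup' (fun H => geodesicInfDist P.region z H) hH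
    exact add_le_add (mul_le_mul_of_nonneg_left (hle _) ha) (mul_le_mul_of_nonneg_left (hle _) hb)
  exact ⟨hrad, fun H hH t => hK.isGeodesicallyConvex_sublevel
    (hK.geodesicallyConvexFun (hconv H hH)) t, hK.isGeodesicallyConvex_sublevel hrad⟩
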